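/- All words are one-sided infinite words $\mathbf w\in\Sigma^{\omega}$ over finite alphabets $\Sigma$. Let $H=\langle h_0,\dots,h_{p-1}\rangle$, $p\ge 1$, be a tuple of morphisms $h_i:\Sigma^*\to\Sigma^*$, let $$H(a_0a_1\cdots a_n)=h_{0}(a_0)\,h_{1 \bmod p}(a_1)\cdots h_{n\bmod p}(a_n),$$ with $H(\varepsilon)=\varepsilon$, and let $s\in\Sigma^*$ be a prefix of $H(s)$. If $\lim_{i\to\infty}H^i(s)$ is infinite, it is called the PD0L word generated by $\langle\Sigma,H,s\rangle$. It is a non-erasing PD0L word if it is generated by such a system in which no $h_i$ maps a letter to the empty word. A word over $\Sigma$ is also regarded as a word over every larger finite alphabet, and the generating system may use such a larger alphabet. A finite state transducer is a deterministic finite automaton that reads its input letter by letter and, on each transition, writes a finite (possibly empty) word depending on the current state and the letter read. Then: 1. The class of PD0L words is not closed under finite state transductions: there are a PD0L word $\mathbf u$ and a finite state transducer that maps $\mathbf u$ to an infinite word that is not a PD0L word. Likewise, the class of non-erasing PD0L words is not closed under finite state transductions. 2. In particular, neither class is closed under erasing letters: for each of the two classes there are a word $\mathbf u$ in the class and a letter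 $a$ such that erasing all occurrences of $a$ from $\mathbf u$ gives an infinite word that is not in the class. 3. An infinite word over a finite alphabet is computable if and only if it is the image of a PD0L word under a finite state transducer, and also if and only if it is the image of a non-erasing PD0L word under a finite state transducer. 4. There is a computable infinite word over a finite alphabet that is not a PD0L word. -/

import Mathlib

/-!
Alphabets are finite types; `List α` is the set of finite words over `α`, and `ℕ → α` is the set
of (one-sided) infinite words over `α`.
-/

/-- The sequence of finite words `v 0, v 1, …` converges to the infinite word `w` in the metric
`d(x, y) = 2 ^ (-n)`, with `n` the length of the longest common prefix of `x` and `y`: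
for each `N`, the word `v n` agrees with `w` on the first `N` letters for all large `n`. -/
def ConvergesToWord {α : Type} (v : ℕ → List α) (w : ℕ → α) : Prop :=
  ∀ N : ℕ, ∀ᶠ n in Filter.atTop, ∀ i < N, (v n)[i]? = some (w i)

/-- The map `H` on finite words determined by a tuple of morphisms `h 0, …, h (p - 1)` (given by
their values on letters): the letter at position `i` is replaced by its image under
`h (i mod p)`. -/
def periodicMap {α : Type} {p : ℕ} (hp : 0 < p) (h : Fin p → α → List α) (x : List α) : List α :=
  (x.mapIdx fun i a => h ⟨i % p, Nat.mod_lt i hp⟩ a).flatten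

/-- A PD0L system over `α`: a nonempty tuple of morphisms, possibly erasing, and a starting
word `s` that is a prefix of `H(s)`. -/
structure PD0LSystem (α : Type) where
  p : ℕ
  p_pos : 0 < p
  h : Fin p → α → List α
  s : List α
  s_prefix : s <+: periodicMap p_pos h s

/-- The map `H` of a PD0L system. -/
def PD0LSystem.map {α : Type} (S : PD0LSystem α) : List α → List α :=
  periodicMap S.p_pos S.h

/-- No morphism of the system maps a letter to the empty word. -/
def PD0LSystem.NonErasing {α : Type} (S : PD0LSystem α) : Prop :=
  ∀ i a, S.h i a ≠ []

/-- The infinite word `w` is the limit of `s, H(s), H(H(s)), …`. -/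
def PD0LSystem.Generates {α : Type} (S : PD0LSystem α) (w : ℕ → α) : Prop :=
  ConvergesToWord (fun n => S.map^[n] S.s) w

/-- A class of infinite words (over varying alphabets). -/
abbrev WordClass : Type 1 := (α : Type) → Set (ℕ → α)

/-- The infinite PD0L words: `w` is generated by a PD0L system over some finite alphabet `β`
that contains the alphabet `α` of `w` (by way of an injection). -/
def PD0LWords : WordClass := fun α =>
  {w | ∃ (β : Type) (_ : Finite β) (ι : α ↪ β) (S : PD0LSystem β),
    S.Generates fun n => ι (w n)}

/-- The infinite words generated by PD0L systems all of whose morphisms are non-erasing. -/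
def NonErasingPD0LWords : WordClass := fun α =>
  {w | ∃ (β : Type) (_ : Finite β) (ι : α ↪ β) (S : PD0LSystem β),
    S.NonErasing ∧ S.Generates fun n => ι (w n)}

/-- The computable infinite words: after some numbering of the (finite) alphabet, the word is a
computable function. -/
def ComputableWords : WordClass := fun α =>
  {w | ∃ (k : ℕ) (e : α ≃ Fin k), Computable fun n => e (w n)}

/-- A deterministic finite state transducer (the states `Q` are required to form a finite type
wherever transducers are used) with input alphabet `α` and output alphabet `β`: reading a letter
`a` in state `q` it writes the word `out q a` and moves to the state `step q a`. -/
structure Transducer (α β Q : Type) where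
  start : Q
  step : Q → α → Q
  out : Q → α → List β

/-- The state reached after reading the first `n` letters of `u`. -/
def Transducer.state {α β Q : Type} (T : Transducer α β Q) (u : ℕ → α) : ℕ → Q
  | 0 => T.start
  | n + 1 => T.step (T.state u n) (u n)

/-- The word written while reading the first `n` letters of `u`. -/
def Transducer.output {α β Q : Type} (T : Transducer α β Q) (u : ℕ → α) (n : ℕ) : List β :=
  (List.range n).flatMap fun i => T.out (T.state u i) (u i)

/-- On input of the infinite word `u`, the transducer produces the infinite word `w`. -/
def Transducer.Transduces {α β Q : Type} (T : Transducer α β Q) (u : ℕ → α) (w : ℕ → β) : Prop :=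
  ConvergesToWord (T.output u) w

/-- The class of all infinite words obtained by applying finite state transducers to the words
in `C`. -/
def transductionsOf (C : WordClass) : WordClass := fun β =>
  {w | ∃ (α : Type) (_ : Finite α) (Q : Type) (_ : Finite Q) (T : Transducer α β Q),
    ∃ u ∈ C α, T.Transduces u w}

/-- Every infinite word over a finite alphabet that is obtained from a word in `C` by a finite
state transducer is again in `C`. -/
def ClosedUnderTransductions (C : WordClass) : Prop :=
  ∀ (β : Type) [Finite β], transductionsOf C β ⊆ C β

/-- The infinite word `w` is obtained from `u` by erasing all occurrences of the letter `a`: it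
lists the letters of `u` at the positions `φ 0 < φ 1 < …` where `u` does not have an `a`. -/
def ErasesLetterTo {α : Type} (a : α) (u w : ℕ → α) : Prop :=
  ∃ φ : ℕ → ℕ, StrictMono φ ∧ Set.range φ = {i | u i ≠ a} ∧ ∀ n, w n = u (φ n)

/-- If erasing a letter from a word in `C` results in an infinite word, then this word is again
in `C`. -/
def ClosedUnderErasingLetters (C : WordClass) : Prop :=
  ∀ (α : Type) [Finite α] (a : α) (u w : ℕ → α), u ∈ C α → ErasesLetterTo a u w → w ∈ C α

/-! The theorem rests on two facts: the characteristic word of the factorials is computable but not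
PD0L, and every computable word arises from a non-erasing PD0L word by erasing letters.

For the first, a PD0L word is fixed by `H`, whose images of letters have length at most some `C`.
Suppose the letter `b` occurs at a late position `t`, inside the image of the letter at position
`n`. If the letter at `n` were the other letter `c`, the same morphism would meet `c` at two late
positions one period apart, giving two occurrences of `b` at bounded distance. So `b` also occurs at
`n < t`, and `t < C * (n + 1)`. Factorials are too sparse for this (`not_generates_of_sparse`).

For the second, a morphism sees the position of a letter modulo the period, which suffices to divide
by `P` with remainder: two applications of `H` turn a block of `N` units into a block whose number
of units is the value at `N` of a generalized Collatz function (`UnitBlock.image`,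
`CountBlock.image`). Such functions simulate register machines when register contents are exponents
of primes (`exists_collatzSystem`). A machine that runs through all times and writes the letters of
a computable word as they become known yields `exists_nonErasingPD0LWord_of_computable`.

Transducers preserve computability, so both classes of transductions equal the computable words, and
the factorial word refutes closure. If erasing one letter preserved a class, so would erasing all
letters that show no output, and the factorial word would be PD0L. -/

/-! ### Prefixes of infinite words -/

/-- The prefix of length `n` of an infinite word. -/
def wordTake {α : Type} (w : ℕ → α) (n : ℕ) : List α := (List.range n).map w

@[simp] theorem length_wordTake {α : Type} (w : ℕ → α) (n : ℕ) : (wordTake w n).length = n := by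
  simp [wordTake]

theorem wordTake_succ {α : Type} (w : ℕ → α) (n : ℕ) :
    wordTake w (n + 1) = wordTake w n ++ [w n] := by
  simp [wordTake, List.range_succ]

theorem getElem?_wordTake {α : Type} (w : ℕ → α) {n i : ℕ} (h : i < n) :
    (wordTake w n)[i]? = some (w i) := by
  simp [wordTake, h]

theorem eq_wordTake_iff {α : Type} {x : List α} {w : ℕ → α} {n : ℕ} (hn : x.length = n) :
    x = wordTake w n ↔ ∀ i < n, x[i]? = some (w i) := by
  constructor
  · rintro h i hi
    rw [h, getElem?_wordTake w hi]
  · intro h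
    refine List.ext_getElem? fun i => ?_
    by_cases hi : i < n
    · rw [h i hi, getElem?_wordTake w hi]
    · rw [List.getElem?_eq_none (by omega), List.getElem?_eq_none (by simp; omega)]

theorem wordTake_prefix {α : Type} (w : ℕ → α) {m n : ℕ} (h : m ≤ n) :
    wordTake w m <+: wordTake w n := by
  induction n, h using Nat.le_induction with
  | base => exact List.prefix_rfl
  | succ n _ ih => rw [wordTake_succ]; exact ih.trans (List.prefix_append _ _)

theorem getElem?_eq_of_prefix {α : Type} {x y : List α} (h : x <+: y) {i : ℕ}
    (hi : i < x.length) : x[i]? = y[i]? := by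
  obtain ⟨z, rfl⟩ := h
  rw [List.getElem?_append_left hi]

theorem eq_wordTake_of_prefix {α : Type} {w : ℕ → α} {x : List α} {n : ℕ}
    (h : x <+: wordTake w n) : x = wordTake w x.length := by
  rw [eq_wordTake_iff rfl]
  intro i hi
  have hn : x.length ≤ n := by simpa using h.length_le
  rw [getElem?_eq_of_prefix h hi, getElem?_wordTake w (by omega)]

theorem prefix_chain_le {α : Type} {v : ℕ → List α} (h : ∀ n, v n <+: v (n + 1)) {m n : ℕ}
    (hmn : m ≤ n) : v m <+: v n := by
  induction n, hmn using Nat.le_induction with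
  | base => exact List.prefix_rfl
  | succ n _ ih => exact ih.trans (h n)

/-- A chain of prefixes converges to `w` iff its members are prefixes of `w` of unbounded
length. -/
theorem convergesToWord_iff {α : Type} {v : ℕ → List α} (h : ∀ n, v n <+: v (n + 1)) {w : ℕ → α} :
    ConvergesToWord v w ↔
      (∀ n, v n = wordTake w (v n).length) ∧ ∀ N, ∃ n, N ≤ (v n).length := by
  constructor
  · intro hc
    constructor
    · intro n
      rw [eq_wordTake_iff rfl]
      intro i hi
      obtain ⟨m, hm, hnm⟩ := ((hc (v n).length).and (Filter.eventually_ge_atTop n)).exists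
      rw [← hm i hi]
      exact getElem?_eq_of_prefix (prefix_chain_le h hnm) hi
    · intro N
      obtain ⟨m, hm⟩ := (hc N).exists
      refine ⟨m, ?_⟩
      by_contra hlt
      have := hm (v m).length (by omega)
      simp at this
  · rintro ⟨h1, h2⟩ N
    obtain ⟨n, hn⟩ := h2 N
    filter_upwards [Filter.eventually_ge_atTop n] with m hm i hi
    have := (prefix_chain_le h hm).length_le
    exact (eq_wordTake_iff rfl).1 (h1 m) i (by omega)

theorem filterMap_range_succ {β : Type} (f : ℕ → Option β) (n : ℕ) :
    (List.range (n + 1)).filterMap f = (List.range n).filterMap f ++ (f n).toList := by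
  rw [List.range_succ, List.filterMap_append, List.filterMap_cons, List.filterMap_nil]
  cases f n <;> rfl

/-! ### Periodic morphisms -/

/-- The map `periodicMap` on a word that starts at position `k` of a longer word. -/
def periodicMapFrom {α : Type} {p : ℕ} (hp : 0 < p) (h : Fin p → α → List α) :
    ℕ → List α → List α
  | _, [] => []
  | k, a :: x => h ⟨k % p, Nat.mod_lt k hp⟩ a ++ periodicMapFrom hp h (k + 1) x

section periodicMapFrom

variable {α : Type} {p : ℕ} (hp : 0 < p) (h : Fin p → α → List α)

@[simp] theorem periodicMapFrom_nil (k : ℕ) : periodicMapFrom hp h k [] = [] := rfl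

theorem periodicMapFrom_cons (k : ℕ) (a : α) (x : List α) :
    periodicMapFrom hp h k (a :: x) =
      h ⟨k % p, Nat.mod_lt k hp⟩ a ++ periodicMapFrom hp h (k + 1) x := rfl

theorem periodicMapFrom_append (k : ℕ) (x y : List α) :
    periodicMapFrom hp h k (x ++ y) =
      periodicMapFrom hp h k x ++ periodicMapFrom hp h (k + x.length) y := by
  induction x generalizing k with
  | nil => simp
  | cons a x ih =>
    simp only [List.cons_append, periodicMapFrom_cons, ih, List.append_assoc, List.length_cons]
    rw [show k + 1 + x.length = k + (x.length + 1) by omega]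

theorem periodicMapFrom_congr {k l : ℕ} (hkl : k ≡ l [MOD p]) (x : List α) :
    periodicMapFrom hp h k x = periodicMapFrom hp h l x := by
  induction x generalizing k l with
  | nil => rfl
  | cons a x ih =>
    have e : k % p = l % p := hkl
    simp only [periodicMapFrom_cons, e, ih (hkl.add_right 1)]

theorem periodicMap_eq_periodicMapFrom (x : List α) :
    periodicMap hp h x = periodicMapFrom hp h 0 x := by
  have key : ∀ k, (x.mapIdx fun i a => h ⟨(i + k) % p, Nat.mod_lt _ hp⟩ a).flatten =
      periodicMapFrom hp h k x := by
    induction x with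
    | nil => simp
    | cons a x ih =>
      intro k
      simp only [List.mapIdx_cons, List.flatten_cons, periodicMapFrom_cons, ← ih (k + 1), zero_add]
      simp only [show ∀ i, i + 1 + k = i + (k + 1) by intros; omega]
  exact key 0

theorem periodicMap_mono {x y : List α} (hxy : x <+: y) :
    periodicMap hp h x <+: periodicMap hp h y := by
  obtain ⟨z, rfl⟩ := hxy
  rw [periodicMap_eq_periodicMapFrom, periodicMap_eq_periodicMapFrom, periodicMapFrom_append]
  exact List.prefix_append _ _

theorem length_periodicMapFrom_le {C : ℕ} (hC : ∀ i a, (h i a).length ≤ C) (k : ℕ) (x : List α) :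
    (periodicMapFrom hp h k x).length ≤ C * x.length := by
  induction x generalizing k with
  | nil => simp
  | cons a x ih =>
    rw [periodicMapFrom_cons, List.length_append, List.length_cons]
    have := ih (k + 1)
    have := hC ⟨k % p, Nat.mod_lt k hp⟩ a
    rw [mul_add]
    omega

end periodicMapFrom

/-! ### Growth of the iterates and the fixed point property -/

namespace PD0LSystem

variable {α : Type} (S : PD0LSystem α)

theorem iterate_prefix (n : ℕ) : S.map^[n] S.s <+: S.map^[n + 1] S.s := by
  induction n with
  | zero => exact S.s_prefix
  | succ n ih =>
    rw [Function.iterate_succ_apply', Function.iterate_succ_apply' (n := n + 1)]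
    exact periodicMap_mono _ _ ih

variable {S} {w : ℕ → α} (hw : S.Generates w)
include hw

theorem Generates.iterate_eq (n : ℕ) :
    S.map^[n] S.s = wordTake w (S.map^[n] S.s).length :=
  ((convergesToWord_iff S.iterate_prefix).1 hw).1 n

/-- An iterate that does not grow equals its successor, hence all later iterates, against the
unbounded lengths. -/
theorem Generates.length_lt (n : ℕ) :
    (S.map^[n] S.s).length < (S.map^[n + 1] S.s).length := by
  by_contra hlt
  have e : S.map^[n + 1] S.s = S.map^[n] S.s :=
    ((S.iterate_prefix n).eq_of_length_le (by omega)).symm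
  have hc : ∀ m, n ≤ m → S.map^[m] S.s = S.map^[n] S.s := by
    intro m hm
    induction m, hm using Nat.le_induction with
    | base => rfl
    | succ m _ ih => rw [Function.iterate_succ_apply', ih, ← Function.iterate_succ_apply' S.map n S.s, e]
  obtain ⟨m, hm⟩ := ((convergesToWord_iff S.iterate_prefix).1 hw).2 ((S.map^[n] S.s).length + 1)
  rcases le_total n m with h | h
  · rw [hc m h] at hm; omega
  · have := (prefix_chain_le S.iterate_prefix h).length_le
    omega

theorem Generates.le_length (n : ℕ) : n ≤ (S.map^[n] S.s).length := by
  induction n with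
  | zero => exact Nat.zero_le _
  | succ n ih => exact Nat.succ_le_of_lt (ih.trans_lt (Generates.length_lt hw n))

/-- A word generated by a system is a fixed point of its map. -/
theorem Generates.map_wordTake (n : ℕ) :
    S.map (wordTake w n) = wordTake w (S.map (wordTake w n)).length := by
  have h1 : wordTake w n <+: S.map^[n] S.s := by
    rw [Generates.iterate_eq hw n]
    exact wordTake_prefix w (Generates.le_length hw n)
  have h2 : S.map (wordTake w n) <+: S.map^[n + 1] S.s := by
    rw [Function.iterate_succ_apply']
    exact periodicMap_mono _ _ h1
  rw [Generates.iterate_eq hw (n + 1)] at h2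
  exact eq_wordTake_of_prefix h2

end PD0LSystem

/-! ### A computable word that is not a PD0L word -/

namespace PD0LSystem

variable {α : Type} {S : PD0LSystem α} {w : ℕ → α}

theorem map_wordTake_succ (S : PD0LSystem α) (w : ℕ → α) (n : ℕ) :
    S.map (wordTake w (n + 1)) =
      S.map (wordTake w n) ++ S.h ⟨n % S.p, Nat.mod_lt n S.p_pos⟩ (w n) := by
  simp only [map, periodicMap_eq_periodicMapFrom, wordTake_succ, periodicMapFrom_append,
    periodicMapFrom_cons, periodicMapFrom_nil, length_wordTake, zero_add, List.append_nil]

theorem length_map_wordTake_le {C : ℕ} (hC : ∀ i a, (S.h i a).length ≤ C) (n : ℕ) :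
    (S.map (wordTake w n)).length ≤ C * n := by
  have := length_periodicMapFrom_le S.p_pos S.h hC 0 (wordTake w n)
  rwa [length_wordTake, ← periodicMap_eq_periodicMapFrom] at this

theorem length_map_wordTake_mono {m n : ℕ} (h : m ≤ n) :
    (S.map (wordTake w m)).length ≤ (S.map (wordTake w n)).length :=
  (periodicMap_mono _ _ (wordTake_prefix w h)).length_le

/-- The image of the letter at position `n` is found in the word right after the image of the
prefix of length `n`. -/
theorem Generates.getElem?_h (hw : S.Generates w) (n d : ℕ) {a : α}
    (hd : (S.h ⟨n % S.p, Nat.mod_lt n S.p_pos⟩ (w n))[d]? = some a) :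
    w ((S.map (wordTake w n)).length + d) = a := by
  have hlt := (List.getElem?_eq_some_iff.1 hd).1
  have h1 := (eq_wordTake_iff rfl).1 (Generates.map_wordTake hw (n + 1))
    ((S.map (wordTake w n)).length + d)
    (by rw [map_wordTake_succ, List.length_append]; omega)
  rw [map_wordTake_succ, List.getElem?_append_right (by omega), Nat.add_sub_cancel_left, hd] at h1
  exact (Option.some.inj h1).symm

/-- Beyond the starting word, the map of a generating system moves all positions to the right. -/
theorem Generates.lt_length_map (hw : S.Generates w) {n : ℕ} (hn : S.s.length ≤ n) :
    n < (S.map (wordTake w n)).length := by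
  by_contra hle
  -- If the prefix of length `n` had an image no longer than itself, no iterate could get past
  -- length `n`.
  have key : ∀ k, (S.map^[k] S.s).length ≤ n := by
    intro k
    induction k with
    | zero => exact hn
    | succ k ih =>
      rw [Function.iterate_succ_apply', Generates.iterate_eq hw k]
      exact (length_map_wordTake_mono ih).trans (by omega)
  have := Generates.le_length hw (n + 1)
  have := key (n + 1)
  omega

/-- A word over two letters in which the occurrences of one letter `b` are superexponentially
sparse is not generated by a PD0L system. -/
theorem not_generates_of_sparse [Finite α] {b c : α} (hbc : ∀ n, w n ≠ b → w n = c)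
    (hinf : ∀ N, ∃ n, N ≤ n ∧ w n = b)
    (hsparse : ∀ C, ∃ N, ∀ m n, N ≤ n → m < n → w m = b → w n = b → C * (m + 1) < n) :
    ¬ S.Generates w := by
  intro hw
  obtain ⟨C, hC⟩ : ∃ C, ∀ i a, (S.h i a).length ≤ C := by
    obtain ⟨C, hC⟩ := (Set.finite_range fun q : Fin S.p × α => (S.h q.1 q.2).length).bddAbove
    exact ⟨C, fun i a => hC ⟨(i, a), rfl⟩⟩
  set g : ℕ → ℕ := fun n => (S.map (wordTake w n)).length with hg
  have hgC : ∀ n, g n ≤ C * n := length_map_wordTake_le hC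
  have hgs : ∀ n, g (n + 1) = g n + (S.h ⟨n % S.p, Nat.mod_lt n S.p_pos⟩ (w n)).length := by
    intro n
    simp only [hg, map_wordTake_succ, List.length_append]
  have hgt : ∀ n, S.s.length ≤ n → n < g n := fun n hn => Generates.lt_length_map hw hn
  have hgm : Monotone g := fun m n h => length_map_wordTake_mono h
  -- the images of `c` do not contain `b`
  have hzero : ∀ n d : ℕ, w n = c → c ≠ b →
      (S.h ⟨n % S.p, Nat.mod_lt n S.p_pos⟩ c)[d]? ≠ some b := by
    intro n d _ hcb hd
    obtain ⟨N₁, hN₁⟩ := hsparse (3 * S.p + 1)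
    obtain ⟨N₂, hN₂⟩ := hsparse (S.p * C + 1)
    have hp := S.p_pos
    obtain ⟨m₀, hm₀, hmod₀⟩ : ∃ m₀, S.s.length + N₁ + N₂ ≤ m₀ ∧ m₀ % S.p = n % S.p := by
      refine ⟨n + S.p * (S.s.length + N₁ + N₂), ?_, by simp⟩
      have := Nat.le_mul_of_pos_left (S.s.length + N₁ + N₂) hp
      omega
    -- At most one of the four late positions `m₀ + p * i`, `i ≤ 3`, carries `b`, so the first two
    -- or the last two both carry `c`.
    have hone : ∀ i j, i < j → j ≤ 3 → w (m₀ + S.p * i) = b → w (m₀ + S.p * j) = b → False := by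
      intro i j hij hj hi hj'
      have h1 : S.p * i < S.p * j := Nat.mul_lt_mul_of_pos_left hij hp
      have h2 : S.p * j ≤ S.p * 3 := Nat.mul_le_mul_left _ hj
      have := hN₁ (m₀ + S.p * i) (m₀ + S.p * j) (by omega) (by omega) hi hj'
      nlinarith [Nat.zero_le (S.p * (m₀ + S.p * i))]
    obtain ⟨m, hm, hmod, hw1, hw2⟩ : ∃ m, S.s.length + N₁ + N₂ ≤ m ∧ m % S.p = n % S.p ∧
        w m = c ∧ w (m + S.p) = c := by
      by_cases h01 : w (m₀ + S.p * 0) ≠ b ∧ w (m₀ + S.p * 1) ≠ b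
      · refine ⟨m₀, hm₀, hmod₀, ?_, ?_⟩
        · simpa using hbc _ h01.1
        · simpa using hbc _ h01.2
      · have hex : ∃ i, i ≤ 1 ∧ w (m₀ + S.p * i) = b := by
          by_contra hne
          push Not at hne
          exact h01 ⟨hne 0 (by omega), hne 1 le_rfl⟩
        obtain ⟨i, hi, hwi⟩ := hex
        refine ⟨m₀ + S.p * 2, by omega, by simp [hmod₀], ?_, ?_⟩
        · exact hbc _ fun h => hone i 2 (by omega) (by omega) hwi h
        · have := hbc _ fun h => hone i 3 (by omega) (by omega) hwi h
          rwa [show m₀ + S.p * 2 + S.p = m₀ + S.p * 3 by ring]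
    -- The same morphism acts at `m` and `m + p`, so `b` occurs twice at a distance of at most `p *
    -- C`, arbitrarily late.
    have hb1 : w (g m + d) = b := Generates.getElem?_h hw m d (by
      rw [hw1]; simpa only [hmod] using hd)
    have hb2 : w (g (m + S.p) + d) = b := Generates.getElem?_h hw (m + S.p) d (by
      rw [hw2]; simpa only [Nat.add_mod_right, hmod] using hd)
    have hlt : g m < g (m + S.p) := by
      have h1 : g (m + 1) ≤ g (m + S.p) := hgm (by omega)
      have h2 := hgs m
      have h3 : d < (S.h ⟨m % S.p, Nat.mod_lt m S.p_pos⟩ (w m)).length := by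
        rw [hw1]
        simpa only [hmod] using (List.getElem?_eq_some_iff.1 hd).1
      omega
    have hle : ∀ q, g (m + q) ≤ g m + q * C := by
      intro q
      induction q with
      | zero => simp
      | succ q ih =>
        have h1 := hgs (m + q)
        have h2 := hC ⟨(m + q) % S.p, Nat.mod_lt _ S.p_pos⟩ (w (m + q))
        rw [← add_assoc, h1, add_mul]
        omega
    have h4 := hgt (m + S.p) (by omega)
    have h5 := hN₂ _ _ (by omega) (by omega) hb1 hb2
    have h6 := hle S.p
    nlinarith [Nat.zero_le (S.p * C * (g m + d))]
  obtain ⟨N, hN⟩ := hsparse C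
  -- The summand `C * (S.s.length + 1)` forces the letter whose image covers `t` to lie beyond the
  -- starting word, where `n < g n`.
  obtain ⟨t, ht, hwt⟩ := hinf (N + C * (S.s.length + 1))
  obtain ⟨n, hn1, hn2⟩ : ∃ n, g n ≤ t ∧ t < g (n + 1) := by
    have hex : ∃ n, t < g n := ⟨S.s.length + t, (by omega : t ≤ S.s.length + t).trans_lt
      (hgt _ (by omega))⟩
    have hpos : Nat.find hex ≠ 0 := by
      intro h0
      have h1 := Nat.find_spec hex
      have h2 := hgC 0
      rw [h0] at h1
      omega
    obtain ⟨n, hn⟩ := Nat.exists_eq_succ_of_ne_zero hpos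
    refine ⟨n, ?_, ?_⟩
    · exact not_lt.1 (Nat.find_min hex (by omega))
    · exact (hn ▸ Nat.find_spec hex : t < g n.succ)
  have hns : S.s.length ≤ n := by
    by_contra hlt
    have h1 := hgC (n + 1)
    have h2 : C * (n + 1) ≤ C * (S.s.length + 1) := Nat.mul_le_mul_left _ (by omega)
    omega
  have hwn : w n = b := by
    by_contra hne
    have hwc := hbc n hne
    refine hzero n (t - g n) hwc (fun h => hne (hwc.trans h)) ?_
    have hlen : t - g n < (S.h ⟨n % S.p, Nat.mod_lt n S.p_pos⟩ (w n)).length := by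
      have := hgs n
      omega
    have h1 := Generates.getElem?_h hw n (t - g n) (List.getElem?_eq_getElem hlen)
    have h2 : (S.map (wordTake w n)).length + (t - g n) = t := by
      change g n + _ = t
      omega
    rw [h2, hwt] at h1
    rw [← hwc, List.getElem?_eq_getElem hlen, ← h1]
  have h1 := hN n t (by omega) ((hgt n hns).trans_le hn1) hwn hwt
  have h2 := hgC (n + 1)
  omega

end PD0LSystem

/-- The characteristic word of the set of factorials. -/
def factorialWord (n : ℕ) : Fin 2 := if ∃ j < n + 1, Nat.factorial j = n then 1 else 0

/-- The bound on `j` in the definition costs nothing, since `j ≤ j!`; it makes the search primitive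
recursive. -/
theorem factorialWord_eq_one_iff (n : ℕ) : factorialWord n = 1 ↔ ∃ j, Nat.factorial j = n := by
  unfold factorialWord
  split_ifs with h
  · exact ⟨fun _ => h.imp fun j hj => hj.2, fun _ => rfl⟩
  · refine ⟨fun h0 => absurd h0 (by decide), fun ⟨j, hj⟩ => absurd ⟨j, ?_, hj⟩ h⟩
    have := Nat.self_le_factorial j
    omega

theorem factorialWord_computable : Computable factorialWord := by
  have hfac : Primrec Nat.factorial := by
    refine (Primrec.nat_rec₁ 1 (f := fun n IH => (n + 1) * IH) ?_).of_eq fun n => ?_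
    · exact Primrec.nat_mul.comp₂ (Primrec.succ.comp Primrec.fst).to₂ Primrec.snd.to₂
    · induction n with
      | zero => rfl
      | succ n ih => rw [Nat.factorial_succ, ← ih]
  have hrel : PrimrecRel fun j n : ℕ => j.factorial = n :=
    Primrec.eq.comp (hfac.comp Primrec.fst) Primrec.snd
  have hpred : PrimrecPred fun n : ℕ => ∃ j < n + 1, Nat.factorial j = n :=
    hrel.exists_lt.comp Primrec.succ Primrec.id
  exact (Primrec.ite hpred (Primrec.const 1) (Primrec.const 0)).to_comp

theorem factorialWord_mem_computableWords : factorialWord ∈ ComputableWords (Fin 2) :=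
  ⟨2, Equiv.refl _, factorialWord_computable⟩

theorem factorialWord_notMem_PD0LWords : factorialWord ∉ PD0LWords (Fin 2) := by
  rintro ⟨β, _, ι, S, hS⟩
  refine PD0LSystem.not_generates_of_sparse (b := ι 1) (c := ι 0) ?_ ?_ ?_ hS
  · intro n hn
    have : factorialWord n ≠ 1 := fun h => hn (congrArg ι h)
    exact congrArg ι (by omega)
  · intro N
    exact ⟨N.factorial, Nat.self_le_factorial N,
      congrArg ι ((factorialWord_eq_one_iff _).2 ⟨N, rfl⟩)⟩
  · intro C
    -- For `m = i!` and `n = j!` one has `C * (m + 1) ≤ 2 * C * m` and `m ≤ (j - 1)!`, so `j > 2 *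
    -- C` suffices.
    refine ⟨(2 * C + 2).factorial, fun m n hn hmn hm hn' => ?_⟩
    obtain ⟨i, rfl⟩ := (factorialWord_eq_one_iff m).1 (ι.injective hm)
    obtain ⟨j, rfl⟩ := (factorialWord_eq_one_iff n).1 (ι.injective hn')
    have hij : i < j := by
      by_contra h
      exact absurd (Nat.factorial_le (not_lt.1 h)) (by omega)
    have hj : 2 * C + 2 ≤ j := by
      by_contra h
      have := (Nat.factorial_lt (n := 2 * C + 1) (m := 2 * C + 2) (by omega)).2 (by omega)
      have := Nat.factorial_le (show j ≤ 2 * C + 1 by omega)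
      omega
    obtain ⟨k, rfl⟩ : ∃ k, j = k + 1 := ⟨j - 1, by omega⟩
    rw [Nat.factorial_succ]
    have h1 : i.factorial ≤ k.factorial := Nat.factorial_le (by omega)
    have h2 : 0 < i.factorial := Nat.factorial_pos i
    nlinarith

/-! ### Transductions of PD0L words are computable -/

/-- A numbering of a finite type makes it primitively recursively encoded. -/
abbrev Equiv.primcodable {α : Type} {k : ℕ} (e : α ≃ Fin k) : Primcodable α :=
  Primcodable.ofEquiv (Fin k) e

theorem mem_computableWords_of_computable {α : Type} [Primcodable α] [Finite α] {w : ℕ → α}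
    (hw : Computable w) : w ∈ ComputableWords α := by
  obtain ⟨k, ⟨e⟩⟩ := Finite.exists_equiv_fin α
  exact ⟨k, e, (Primrec.dom_finite e).to_comp.comp hw⟩

theorem computable_of_mem_computableWords {α : Type} [Primcodable α] [Finite α] {w : ℕ → α}
    (hw : w ∈ ComputableWords α) : Computable w := by
  obtain ⟨k, e, he⟩ := hw
  exact ((Primrec.dom_finite e.symm).to_comp.comp he).of_eq fun n => e.symm_apply_apply _

/-- The map of a PD0L system is primitive recursive. -/
theorem PD0LSystem.primrec_map {α : Type} [Primcodable α] [Finite α] (S : PD0LSystem α) :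
    Primrec S.map := by
  have hidx : Primrec fun i : ℕ => (⟨i % S.p, Nat.mod_lt i S.p_pos⟩ : Fin S.p) :=
    Primrec.fin_val_iff.1 (Primrec.nat_mod.comp Primrec.id (Primrec.const S.p))
  have hh : Primrec fun q : Fin S.p × α => S.h q.1 q.2 := Primrec.dom_finite _
  have hletter : Primrec₂ fun (x : List α) (i : ℕ) =>
      (x[i]?).elim [] fun a => S.h ⟨i % S.p, Nat.mod_lt i S.p_pos⟩ a := by
    refine (Primrec.option_casesOn (o := fun q : List α × ℕ => q.1[q.2]?) (f := fun _ => [])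
      (g := fun q a => S.h ⟨q.2 % S.p, Nat.mod_lt q.2 S.p_pos⟩ a)
      (Primrec.list_getElem?.comp Primrec.fst Primrec.snd) (Primrec.const []) ?_).of_eq ?_
    · exact hh.comp (Primrec.pair (hidx.comp (Primrec.snd.comp Primrec.fst)) Primrec.snd)
    · rintro ⟨x, i⟩
      dsimp only
      cases x[i]? <;> rfl
  refine (Primrec.list_flatMap (Primrec.list_range.comp Primrec.list_length) hletter).of_eq ?_
  intro x
  rw [map, periodicMap, List.flatMap_def]
  congr 1
  refine List.ext_getElem? fun i => ?_
  rw [List.getElem?_mapIdx]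
  by_cases hi : i < x.length
  · simp [hi]
  · simp [hi]

/-- Iterates grow by at least one letter each time, so the letter at `n` can be read off the iterate
number `n + 1`. -/
theorem PD0LSystem.Generates.mem_computableWords {α : Type} [Finite α] {S : PD0LSystem α}
    {w : ℕ → α} (hw : S.Generates w) : w ∈ ComputableWords α := by
  obtain ⟨k, ⟨e⟩⟩ := Finite.exists_equiv_fin α
  let := e.primcodable
  have hit : Primrec fun n : ℕ => S.map^[n + 1] S.s :=
    Primrec.nat_iterate Primrec.succ (Primrec.const S.s) (S.primrec_map.comp Primrec.snd)
  have hget : Primrec fun n : ℕ => (S.map^[n + 1] S.s)[n]? :=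
    Primrec.list_getElem?.comp hit Primrec.id
  refine mem_computableWords_of_computable (Primrec.option_some_iff.1 (hget.of_eq fun n => ?_)).to_comp
  exact (eq_wordTake_iff rfl).1 (Generates.iterate_eq hw (n + 1)) n (Generates.le_length hw (n + 1))

/-- The system may use a larger alphabet; a left inverse of the injection brings the word back. -/
theorem mem_computableWords_of_mem_PD0LWords {α : Type} [Finite α] {u : ℕ → α}
    (hu : u ∈ PD0LWords α) : u ∈ ComputableWords α := by
  obtain ⟨β, _, ι, S, hS⟩ := hu
  obtain ⟨l, ⟨e'⟩⟩ := Finite.exists_equiv_fin β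
  obtain ⟨k, ⟨e⟩⟩ := Finite.exists_equiv_fin α
  let := e'.primcodable
  let := e.primcodable
  have : Nonempty α := ⟨u 0⟩
  have h1 := computable_of_mem_computableWords (PD0LSystem.Generates.mem_computableWords hS)
  refine mem_computableWords_of_computable
    (((Primrec.dom_finite (Function.invFun ι)).to_comp.comp h1).of_eq fun n => ?_)
  exact Function.leftInverse_invFun ι.injective (u n)

theorem NonErasingPD0LWords_subset_PD0LWords (α : Type) :
    NonErasingPD0LWords α ⊆ PD0LWords α := by
  rintro w ⟨β, hβ, ι, S, -, hS⟩
  exact ⟨β, hβ, ι, S, hS⟩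

theorem Transducer.output_succ {α β Q : Type} (T : Transducer α β Q) (u : ℕ → α) (n : ℕ) :
    T.output u (n + 1) = T.output u n ++ T.out (T.state u n) (u n) := by
  simp [Transducer.output, List.range_succ]

theorem Transducer.transduces_iff {α β Q : Type} (T : Transducer α β Q) (u : ℕ → α) (w : ℕ → β) :
    T.Transduces u w ↔ (∀ n, T.output u n = wordTake w (T.output u n).length) ∧
      ∀ N, ∃ n, N ≤ (T.output u n).length :=
  convergesToWord_iff fun n => by rw [T.output_succ]; exact List.prefix_append _ _

theorem Transducer.computable_output {α β Q : Type} [Primcodable α] [Primcodable β] [Primcodable Q]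
    [Finite α] [Finite Q] (T : Transducer α β Q) {u : ℕ → α} (hu : Computable u) :
    Computable (T.output u) := by
  have hout : Computable₂ T.out := (Primrec.dom_finite _).to_comp
  have hstep : Computable₂ T.step := (Primrec.dom_finite _).to_comp
  have hs : Computable fun x : ℕ × (ℕ × (Q × List β)) => x.2.2.1 :=
    Computable.fst.comp (Computable.snd.comp Computable.snd)
  have hi : Computable fun x : ℕ × (ℕ × (Q × List β)) => u x.2.1 :=
    hu.comp (Computable.fst.comp Computable.snd)
  have hq : Computable fun x : ℕ × (ℕ × (Q × List β)) => T.step x.2.2.1 (u x.2.1) :=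
    hstep.comp hs hi
  have ho : Computable fun x : ℕ × (ℕ × (Q × List β)) => T.out x.2.2.1 (u x.2.1) :=
    hout.comp hs hi
  have hl : Computable fun x : ℕ × (ℕ × (Q × List β)) => x.2.2.2 :=
    Computable.snd.comp (Computable.snd.comp Computable.snd)
  have hl' : Computable fun x : ℕ × (ℕ × (Q × List β)) =>
      x.2.2.2 ++ T.out x.2.2.1 (u x.2.1) :=
    Computable₂.comp Computable.list_append hl ho
  have hnext : Computable₂ fun (_ : ℕ) (x : ℕ × (Q × List β)) =>
      (T.step x.2.1 (u x.1), x.2.2 ++ T.out x.2.1 (u x.1)) :=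
    Computable.pair hq hl'
  have hrec := Computable.nat_rec (Computable.id (α := ℕ))
    (Computable.const (α := ℕ) (T.start, ([] : List β))) hnext
  have hrun : ∀ n, (Nat.rec (T.start, []) (fun i x => (T.step x.1 (u i), x.2 ++ T.out x.1 (u i))) n :
      Q × List β) = (T.state u n, T.output u n) := by
    intro n
    induction n with
    | zero => rfl
    | succ n ih =>
      rw [T.output_succ]
      simp only [ih]
      rfl
  exact (Computable.snd.comp hrec).of_eq fun n => congrArg Prod.snd (hrun n)

/-- Search for a prefix long enough to contain position `n`: the lengths are unbounded, so the
search stops, and any prefix found shows the right letter. -/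
theorem computable_of_computable_prefixes {β : Type} [Primcodable β] {v : ℕ → List β} {w : ℕ → β}
    (hv : Computable v) (h1 : ∀ n, v n = wordTake w (v n).length)
    (h2 : ∀ N, ∃ n, N ≤ (v n).length) : Computable w := by
  have hv2 : Computable fun x : ℕ × ℕ => v x.2 := hv.comp Computable.snd
  have hget : Computable₂ fun n m => (v m)[n]? :=
    Computable₂.comp Computable.list_getElem? hv2 Computable.fst
  refine (Partrec.rfindOpt hget).of_eq fun n => ?_
  obtain ⟨m, hm⟩ := h2 (n + 1)
  have hdom : (Nat.rfindOpt fun m => (v m)[n]?).Dom :=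
    Nat.rfindOpt_dom.2 ⟨m, w n, (eq_wordTake_iff rfl).1 (h1 m) n (by omega)⟩
  obtain ⟨a, ha⟩ := Part.dom_iff_mem.1 hdom
  obtain ⟨m', hm'⟩ := Nat.rfindOpt_spec ha
  have hlt := (List.getElem?_eq_some_iff.1 hm').1
  obtain rfl : a = w n :=
    Option.some.inj (hm'.symm.trans ((eq_wordTake_iff rfl).1 (h1 m') n hlt))
  exact Part.eq_some_iff.2 ha

theorem Transducer.Transduces.mem_computableWords {α β Q : Type} [Finite α] [Finite β] [Finite Q]
    {T : Transducer α β Q} {u : ℕ → α} {w : ℕ → β} (hT : T.Transduces u w)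
    (hu : u ∈ ComputableWords α) : w ∈ ComputableWords β := by
  obtain ⟨_, ⟨eα⟩⟩ := Finite.exists_equiv_fin α
  obtain ⟨_, ⟨eβ⟩⟩ := Finite.exists_equiv_fin β
  obtain ⟨_, ⟨eQ⟩⟩ := Finite.exists_equiv_fin Q
  let := eα.primcodable
  let := eβ.primcodable
  let := eQ.primcodable
  have hrun := T.computable_output (computable_of_mem_computableWords hu)
  obtain ⟨h1, h2⟩ := (T.transduces_iff u w).1 hT
  exact mem_computableWords_of_computable (computable_of_computable_prefixes hrun h1 h2)

theorem transductionsOf_PD0LWords_subset (β : Type) [Finite β] :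
    transductionsOf PD0LWords β ⊆ ComputableWords β := by
  rintro w ⟨α, _, Q, _, T, u, hu, hT⟩
  exact hT.mem_computableWords (mem_computableWords_of_mem_PD0LWords hu)

theorem transductionsOf_mono {C D : WordClass} (h : ∀ α, C α ⊆ D α) (β : Type) :
    transductionsOf C β ⊆ transductionsOf D β := by
  rintro w ⟨α, hα, Q, hQ, T, u, hu, hT⟩
  exact ⟨α, hα, Q, hQ, T, u, h α hu, hT⟩

/-! ### Generalized Collatz functions and PD0L words -/

/-- A generalized Collatz function `N ↦ m r * (N / P) + k r`, where `r` is the residue of `N`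
modulo `P`, with an optional output letter for each residue. -/
structure CollatzSystem (σ : Type) where
  P : ℕ
  P_pos : 0 < P
  m : ℕ → ℕ
  k : ℕ → ℕ
  o : ℕ → Option σ

namespace CollatzSystem

variable {σ : Type} (T : CollatzSystem σ)

def next (N : ℕ) : ℕ := T.m (N % T.P) * (N / T.P) + T.k (N % T.P)

def output (N : ℕ) : Option σ := T.o (N % T.P)

/-- The outputs of the first `n` steps, starting from `N`. -/
def outputs (N n : ℕ) : List σ := (List.range n).filterMap fun i => T.output (T.next^[i] N)

theorem outputs_succ (N n : ℕ) :
    T.outputs N (n + 1) = T.outputs N n ++ (T.output (T.next^[n] N)).toList :=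
  filterMap_range_succ _ n

theorem outputs_add (N m n : ℕ) :
    T.outputs N (m + n) = T.outputs N m ++ T.outputs (T.next^[m] N) n := by
  induction n with
  | zero => simp [outputs]
  | succ n ih =>
    rw [← add_assoc, outputs_succ, ih, outputs_succ, List.append_assoc, ← Function.iterate_add_apply,
      add_comm n m]

end CollatzSystem

/-- The letters of the PD0L word that simulates a generalized Collatz function. -/
inductive CollatzLetter (σ : Type) : Type
  | start | unit | sep | pad | mark | junk
  | count (full : Bool)
  | out (a : σ)

namespace CollatzLetter

instance {σ : Type} [Finite σ] : Finite (CollatzLetter σ) := by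
  refine Finite.of_injective (β := Fin 7 × Bool × Option σ) (fun
    | start => (0, false, none) | unit => (1, false, none) | sep => (2, false, none)
    | pad => (3, false, none) | mark => (4, false, none) | junk => (5, false, none)
    | count b => (6, b, none) | out a => (0, false, some a)) ?_
  intro x y h
  cases x <;> cases y <;> simp_all

/-- The letter of the output alphabet that is shown by a letter. -/
def shown {σ : Type} : CollatzLetter σ → Option σ
  | out a => some a
  | _ => none

theorem shown_eq_some_iff {σ : Type} {x : CollatzLetter σ} {a : σ} :
    x.shown = some a ↔ x = out a := by
  cases x <;> simp [shown]

theorem filterMap_replicate {σ : Type} {x : CollatzLetter σ} (hx : x.shown = none) (n : ℕ) :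
    (List.replicate n x).filterMap shown = [] := by
  induction n with
  | zero => rfl
  | succ n ih => rw [List.replicate_succ, List.filterMap_cons_none hx, ih]

end CollatzLetter

/-! ### Simulation of a generalized Collatz function by periodic morphisms -/

namespace CollatzSystem

open CollatzLetter

variable {σ : Type} (T : CollatzSystem σ)

/-- The word that shows an optional output letter. -/
def outWord : Option σ → List (CollatzLetter σ)
  | none => []
  | some a => out a :: List.replicate (T.P - 1) junk

/-- The word that is written behind the starting letter. -/
def initialBlock (N : ℕ) : List (CollatzLetter σ) :=
  List.replicate N unit ++ sep :: List.replicate (2 * T.P) junk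

/-- The morphisms that simulate a generalized Collatz function with starting value `N`. -/
def morphism (N : ℕ) (i : Fin T.P) : CollatzLetter σ → List (CollatzLetter σ)
  | start => start :: T.initialBlock N
  | unit => count (i.val = 0) :: List.replicate (T.P - 1) pad
  -- For a block of `n` units the separator stands at `n + 1` modulo `P`, so adding `P - 1` gives `r
  -- = n % P`. The next block starts at `r + 2`, and the junk makes it end so that the one after
  -- starts at `1`. The factor `2` is needed as `r + 2` may be `P + 1`.
  | sep => mark :: List.replicate (2 * T.P - ((i.val + (T.P - 1)) % T.P + 2)) junk
  | pad => [junk]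
  | mark =>
    -- Adding `2 * P - 2` subtracts `2` modulo `P`, and `mark` stands at `n + 2`. The `r + 2`
    -- letters of junk complete the junk inherited from the separator to a multiple of `P`.
    let r := (i.val + (2 * T.P - 2)) % T.P
    List.replicate (T.k r) unit ++ T.outWord (T.o r) ++ sep :: List.replicate (r + 2) junk
  | junk => [junk]
  | count b =>
    (if b then List.replicate (T.m ((i.val + (2 * T.P - 2)) % T.P)) unit else []) ++ [junk]
  | out _ => [junk]

theorem morphism_ne_nil (N : ℕ) (i : Fin T.P) (a : CollatzLetter σ) : T.morphism N i a ≠ [] := by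
  cases a <;> simp [morphism]

/-- The image of a word that starts at position `k`. -/
def image (N k : ℕ) (x : List (CollatzLetter σ)) : List (CollatzLetter σ) :=
  periodicMapFrom T.P_pos (T.morphism N) k x

/-- Words in which, apart from junk of length divisible by the period, the letter `unit` occurs
`n` times. -/
inductive UnitWord : ℕ → List (CollatzLetter σ) → Prop
  | nil : UnitWord 0 []
  | addUnit {n l} : UnitWord n l → UnitWord (n + 1) (unit :: l)
  | addJunk {n l} : UnitWord n l → UnitWord n (List.replicate T.P junk ++ l)
  | addOut {n l} (a : σ) : UnitWord n l →
      UnitWord n ((out a :: List.replicate (T.P - 1) junk) ++ l)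

/-- Words in which, apart from junk of length divisible by the period, there are padded letters
`count b`, with `b` true `t` times. -/
inductive CountWord : ℕ → List (CollatzLetter σ) → Prop
  | nil : CountWord 0 []
  | addCount {t l} (b : Bool) : CountWord t l →
      CountWord (b.toNat + t) ((count b :: List.replicate (T.P - 1) pad) ++ l)
  | addJunk {t l} : CountWord t l → CountWord t (List.replicate T.P junk ++ l)

variable {T}

theorem cons_replicate_pred {β : Type} (x : β) :
    x :: List.replicate (T.P - 1) x = List.replicate T.P x := by
  rw [← List.replicate_succ, Nat.sub_add_cancel T.P_pos]

theorem image_append (N k : ℕ) (x y : List (CollatzLetter σ)) :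
    T.image N k (x ++ y) = T.image N k x ++ T.image N (k + x.length) y :=
  periodicMapFrom_append _ _ _ _ _

theorem image_cons (N k : ℕ) (a : CollatzLetter σ) (x : List (CollatzLetter σ)) :
    T.image N k (a :: x) = T.morphism N ⟨k % T.P, Nat.mod_lt k T.P_pos⟩ a ++ T.image N (k + 1) x :=
  rfl

theorem image_replicate {N : ℕ} {x : CollatzLetter σ} (hx : ∀ i, T.morphism N i x = [junk])
    (n k : ℕ) : T.image N k (List.replicate n x) = List.replicate n junk := by
  induction n generalizing k with
  | zero => rfl
  | succ n ih => rw [List.replicate_succ, image_cons, ih, hx, List.replicate_succ]; rfl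

theorem image_add_period (N k : ℕ) (x : List (CollatzLetter σ)) :
    T.image N (k + T.P) x = T.image N k x :=
  periodicMapFrom_congr _ _ (by simp [Nat.ModEq]) _

theorem image_period_junk (N k : ℕ) (x : List (CollatzLetter σ)) :
    T.image N k (List.replicate T.P junk ++ x) = List.replicate T.P junk ++ T.image N k x := by
  rw [image_append, image_replicate fun _ => rfl, List.length_replicate]
  rw [image_add_period]

theorem UnitWord.replicate_append {n : ℕ} {l : List (CollatzLetter σ)} (h : T.UnitWord n l)
    (a : ℕ) : T.UnitWord (a + n) (List.replicate a unit ++ l) := by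
  induction a with
  | zero => simpa using h
  | succ a ih =>
    rw [Nat.add_right_comm]
    exact ih.addUnit

theorem UnitWord.append {n n' : ℕ} {l l' : List (CollatzLetter σ)} (h : T.UnitWord n l)
    (h' : T.UnitWord n' l') : T.UnitWord (n + n') (l ++ l') := by
  induction h with
  | nil => simpa using h'
  | addUnit _ ih => rw [Nat.add_right_comm]; exact ih.addUnit
  | addJunk _ ih => rw [List.append_assoc]; exact ih.addJunk
  | addOut a _ ih => rw [List.append_assoc]; exact ih.addOut a

theorem UnitWord.length_modEq {n : ℕ} {l : List (CollatzLetter σ)} (h : T.UnitWord n l) :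
    l.length ≡ n [MOD T.P] := by
  have hP := T.P_pos
  induction h with
  | nil => rfl
  | addUnit _ ih => exact ih.add_right 1
  | addJunk _ ih => simpa [Nat.ModEq] using ih
  | addOut a _ ih =>
    rw [List.length_append, List.length_cons, List.length_replicate, Nat.sub_add_cancel hP]
    simpa [Nat.ModEq] using ih

theorem CountWord.length_modEq {t : ℕ} {l : List (CollatzLetter σ)} (h : T.CountWord t l) :
    l.length ≡ 0 [MOD T.P] := by
  have hP := T.P_pos
  induction h with
  | nil => rfl
  | addCount b _ ih =>
    rw [List.length_append, List.length_cons, List.length_replicate, Nat.sub_add_cancel hP]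
    simpa [Nat.ModEq] using ih
  | addJunk _ ih => simpa [Nat.ModEq] using ih

theorem CountWord.filterMap_shown {t : ℕ} {l : List (CollatzLetter σ)} (h : T.CountWord t l) :
    l.filterMap shown = [] := by
  induction h with
  | nil => rfl
  | addCount b _ ih =>
    rw [List.filterMap_append, ih, List.filterMap_cons_none rfl, filterMap_replicate rfl,
      List.append_nil]
  | addJunk _ ih => rw [List.filterMap_append, ih, filterMap_replicate rfl, List.append_nil]

/-- Division by `P`: consecutive units meet consecutive residues, so exactly every `P`-th one gets
the flag. The parameter `j` counts the units already passed, which makes the induction go through.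
-/
theorem UnitWord.image {n : ℕ} {l : List (CollatzLetter σ)} (h : T.UnitWord n l) (N : ℕ)
    {k j : ℕ} (hk : k ≡ j + 1 [MOD T.P]) :
    ∃ t, T.CountWord t (T.image N k l) ∧ j / T.P + t = (j + n) / T.P := by
  have hP := T.P_pos
  induction h generalizing k j with
  | nil => exact ⟨0, .nil, rfl⟩
  | @addUnit n l _ ih =>
    obtain ⟨t, ht, htn⟩ := ih (hk.add_right 1)
    refine ⟨(decide (k % T.P = 0)).toNat + t, ht.addCount _, ?_⟩
    have hflag : k % T.P = 0 ↔ T.P ∣ j + 1 := by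
      rw [Nat.dvd_iff_mod_eq_zero, ← show k % T.P = (j + 1) % T.P from hk]
    rw [show j + (n + 1) = j + 1 + n by omega, ← htn, Nat.succ_div]
    by_cases hd : T.P ∣ j + 1
    · simp [hd, hflag.2 hd, add_assoc]
    · simp [hd, hflag.not.2 hd]
  | addJunk _ ih =>
    obtain ⟨t, ht, htn⟩ := ih hk
    refine ⟨t, ?_, htn⟩
    rw [image_period_junk]
    exact ht.addJunk
  | addOut a _ ih =>
    obtain ⟨t, ht, htn⟩ := ih hk
    refine ⟨t, ?_, htn⟩
    rw [List.cons_append, image_cons, image_append, image_replicate fun _ => rfl,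
      ← List.append_assoc]
    have e : T.morphism N ⟨k % T.P, Nat.mod_lt k T.P_pos⟩ (out a) ++
        List.replicate (T.P - 1) junk = List.replicate T.P junk :=
      cons_replicate_pred _
    rw [e, List.length_replicate, add_assoc, Nat.add_sub_cancel' hP]
    rw [image_add_period]
    exact ht.addJunk

/-- Multiplication by `m r`: all groups have length `P`, so every `count` letter sees the same
residue, which reveals `r`. Each flagged one produces `m r` units. -/
theorem CountWord.image {t : ℕ} {l : List (CollatzLetter σ)} (h : T.CountWord t l) (N : ℕ)
    {k r : ℕ} (hk : k ≡ r + 2 [MOD T.P]) (hr : r < T.P) :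
    T.UnitWord (T.m r * t) (T.image N k l) ∧ (T.image N k l).filterMap shown = [] := by
  have hP := T.P_pos
  have hres : (k % T.P + (2 * T.P - 2)) % T.P = r := by
    rw [Nat.mod_add_mod]
    have h1 := hk.add_right (2 * T.P - 2)
    rw [show r + 2 + (2 * T.P - 2) = r + 2 * T.P by omega] at h1
    rw [h1]
    simp [Nat.mod_eq_of_lt hr]
  induction h with
  | nil => exact ⟨.nil, rfl⟩
  | @addCount t l b _ ih =>
    obtain ⟨h1, h2⟩ := ih
    have e : T.image N k ((count b :: List.replicate (T.P - 1) pad) ++ l) =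
        List.replicate (T.m r * b.toNat) unit ++ (List.replicate T.P junk ++ T.image N k l) := by
      rw [List.cons_append, image_cons, image_append, image_replicate fun _ => rfl,
        List.length_replicate, add_assoc, Nat.add_sub_cancel' hP]
      rw [image_add_period, ← cons_replicate_pred]
      simp only [morphism, hres]
      cases b <;> simp
    rw [e, mul_add]
    refine ⟨UnitWord.replicate_append h1.addJunk _, ?_⟩
    rw [List.filterMap_append, List.filterMap_append, filterMap_replicate rfl,
      filterMap_replicate rfl, h2]
    rfl
  | addJunk _ ih =>
    rw [image_period_junk, List.filterMap_append, filterMap_replicate rfl, ih.2]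
    exact ⟨ih.1.addJunk, rfl⟩

variable (T) in
/-- The words that encode the number `n` by `n` letters `unit`. -/
def UnitBlock (n : ℕ) (l : List (CollatzLetter σ)) : Prop :=
  ∃ l' d, T.P ∣ d ∧ l = l' ++ sep :: List.replicate d junk ∧ T.UnitWord n l'

variable (T) in
/-- The words that encode the number `n` by the phase of the letters in them. -/
def CountBlock (n : ℕ) (l : List (CollatzLetter σ)) : Prop :=
  ∃ l' d, T.P ∣ n % T.P + 2 + d ∧ l = l' ++ mark :: List.replicate d junk ∧
    T.CountWord (n / T.P) l'

theorem unitBlock_initialBlock (n : ℕ) : T.UnitBlock n (T.initialBlock n) :=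
  ⟨List.replicate n unit, 2 * T.P, Dvd.intro_left 2 rfl, rfl,
    by simpa using UnitWord.replicate_append .nil n⟩

/-- First half of a Collatz step: the quotient of `n` goes into the number of flags, the remainder
into the position at which the image begins. -/
theorem UnitBlock.image {n : ℕ} {l : List (CollatzLetter σ)} (h : T.UnitBlock n l) (N : ℕ) {k : ℕ}
    (hk : k ≡ 1 [MOD T.P]) :
    T.CountBlock n (T.image N k l) ∧ k + l.length ≡ n + 2 [MOD T.P] ∧
      (T.image N k l).filterMap shown = [] := by
  have hP := T.P_pos
  obtain ⟨l', d, hd, rfl, hl⟩ := h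
  obtain ⟨t, ht, htn⟩ := UnitWord.image hl N (j := 0) hk
  rw [Nat.zero_div, zero_add, zero_add] at htn
  subst htn
  have hlen := hl.length_modEq
  have hres : ((k + l'.length) % T.P + (T.P - 1)) % T.P = n % T.P := by
    rw [Nat.mod_add_mod]
    have h1 := (hk.add hlen).add_right (T.P - 1)
    rw [show 1 + n + (T.P - 1) = n + T.P by omega] at h1
    rw [h1]
    simp
  have e : T.image N k (l' ++ sep :: List.replicate d junk) =
      T.image N k l' ++ mark :: List.replicate (2 * T.P - (n % T.P + 2) + d) junk := by
    rw [image_append, image_cons, image_replicate fun _ => rfl]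
    simp only [morphism, hres, List.cons_append, List.replicate_append_replicate]
  refine ⟨⟨_, _, ?_, e, ht⟩, ?_, ?_⟩
  · have := Nat.mod_lt n hP
    rw [← add_assoc, Nat.add_sub_cancel' (by omega)]
    exact Dvd.dvd.add (Dvd.intro_left 2 rfl) hd
  · rw [List.length_append, List.length_cons, List.length_replicate]
    have h1 := (hk.add hlen).add ((Nat.modEq_zero_iff_dvd.2 hd).add_right 1)
    rw [show 1 + n + (0 + 1) = n + 2 by omega] at h1
    rwa [← add_assoc k]
  · rw [e, List.filterMap_append, ht.filterMap_shown, List.filterMap_cons_none rfl,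
      filterMap_replicate rfl]
    rfl

theorem unitWord_outWord (a : Option σ) : T.UnitWord 0 (T.outWord a) := by
  cases a with
  | none => exact .nil
  | some a => simpa [outWord] using UnitWord.nil.addOut (T := T) a

theorem filterMap_outWord (a : Option σ) : (T.outWord a).filterMap shown = a.toList := by
  cases a with
  | none => rfl
  | some a =>
    rw [outWord, List.filterMap_cons_some (f := shown) (b := a) rfl, filterMap_replicate rfl]
    rfl

/-- Second half of a Collatz step: the remainder, read from the position, selects the factor, the
summand and the output; the position returns to `1`. -/
theorem CountBlock.image {n : ℕ} {l : List (CollatzLetter σ)} (h : T.CountBlock n l) (N : ℕ)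
    {k : ℕ} (hk : k ≡ n + 2 [MOD T.P]) :
    T.UnitBlock (T.next n) (T.image N k l) ∧ k + l.length ≡ 1 [MOD T.P] ∧
      (T.image N k l).filterMap shown = (T.output n).toList := by
  have hP := T.P_pos
  obtain ⟨l', d, hd, rfl, hl⟩ := h
  have hk' : k ≡ n % T.P + 2 [MOD T.P] := hk.trans ((Nat.mod_modEq n T.P).symm.add_right 2)
  obtain ⟨h1, h2⟩ := CountWord.image hl N hk' (Nat.mod_lt n hP)
  have hlen := hl.length_modEq
  have hres : ((k + l'.length) % T.P + (2 * T.P - 2)) % T.P = n % T.P := by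
    rw [Nat.mod_add_mod]
    have h1 := (hk.add hlen).add_right (2 * T.P - 2)
    rw [show n + 2 + 0 + (2 * T.P - 2) = n + 2 * T.P by omega] at h1
    rw [h1]
    simp
  have e : T.image N k (l' ++ mark :: List.replicate d junk) =
      (T.image N k l' ++ (List.replicate (T.k (n % T.P)) unit ++ T.outWord (T.output n))) ++
        sep :: List.replicate (n % T.P + 2 + d) junk := by
    rw [image_append, image_cons, image_replicate fun _ => rfl]
    simp only [morphism, hres, List.cons_append, List.append_assoc,
      List.replicate_append_replicate, CollatzSystem.output]
  refine ⟨⟨_, _, hd, e, h1.append ?_⟩, ?_, ?_⟩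
  · simpa using UnitWord.replicate_append (unitWord_outWord (T.output n)) (T.k (n % T.P))
  · rw [List.length_append, List.length_cons, List.length_replicate]
    have h1 := ((hk'.add hlen).add_right d).add_right 1
    have h2 := (Nat.modEq_zero_iff_dvd.2 hd).add_right 1
    rw [add_zero] at h1
    simpa only [add_assoc, zero_add] using h1.trans h2
  · rw [e, List.filterMap_append, List.filterMap_append, List.filterMap_append, h2,
      filterMap_replicate rfl, filterMap_outWord, List.filterMap_cons_none rfl,
      filterMap_replicate rfl]
    simp

theorem image_ne_nil (N k : ℕ) {x : List (CollatzLetter σ)} (hx : x ≠ []) :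
    T.image N k x ≠ [] := by
  obtain ⟨a, x, rfl⟩ := List.exists_cons_of_ne_nil hx
  rw [image_cons]
  exact List.append_ne_nil_of_left_ne_nil (T.morphism_ne_nil N _ a) _

/-! ### The simulating PD0L system and its limit word -/

variable (T)

/-- The non-erasing PD0L system that simulates a generalized Collatz function with starting value
`N`. -/
def toPD0LSystem (N : ℕ) : PD0LSystem (CollatzLetter σ) where
  p := T.P
  p_pos := T.P_pos
  h := T.morphism N
  s := [start]
  s_prefix := ⟨T.initialBlock N, by
    rw [periodicMap_eq_periodicMapFrom, periodicMapFrom_cons, periodicMapFrom_nil,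
      List.append_nil]
    rfl⟩

/-- The iterates of the system, each with the word that is appended to it next. -/
def stage (N : ℕ) : ℕ → List (CollatzLetter σ) × List (CollatzLetter σ)
  | 0 => ([start], T.initialBlock N)
  | n + 1 => ((stage N n).1 ++ (stage N n).2, T.image N (stage N n).1.length (stage N n).2)

theorem map_stage (N n : ℕ) :
    (T.toPD0LSystem N).map (T.stage N n).1 = (T.stage N n).1 ++ (T.stage N n).2 := by
  have hmap : ∀ x, (T.toPD0LSystem N).map x = T.image N 0 x :=
    fun x => periodicMap_eq_periodicMapFrom _ _ x
  induction n with
  | zero =>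
    rw [hmap, stage, image_cons]
    exact List.append_nil _
  | succ n ih =>
    rw [hmap] at ih ⊢
    rw [stage, image_append, ih, zero_add]

theorem iterate_map (N n : ℕ) :
    (T.toPD0LSystem N).map^[n] (T.toPD0LSystem N).s = (T.stage N n).1 := by
  induction n with
  | zero => rfl
  | succ n ih =>
    rw [Function.iterate_succ_apply', ih, map_stage, stage]

theorem lt_length_stage (N n : ℕ) : n < (T.stage N n).1.length ∧ (T.stage N n).2 ≠ [] := by
  induction n with
  | zero => exact ⟨Nat.one_pos, by simp [stage, initialBlock]⟩
  | succ n ih =>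
    refine ⟨?_, image_ne_nil N _ ih.2⟩
    have := List.length_pos_iff.2 ih.2
    rw [stage, List.length_append]
    omega

/-- Even stages hold the successive Collatz values in unary, since two applications of the map make
one Collatz step. -/
theorem stage_two_mul (N i : ℕ) :
    T.UnitBlock (T.next^[i] N) (T.stage N (2 * i)).2 ∧
      (T.stage N (2 * i)).1.length ≡ 1 [MOD T.P] ∧
      ((T.stage N (2 * i)).1 ++ (T.stage N (2 * i)).2).filterMap shown = T.outputs N i := by
  induction i with
  | zero =>
    refine ⟨unitBlock_initialBlock N, rfl, ?_⟩
    change (start :: T.initialBlock N).filterMap shown = []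
    rw [List.filterMap_cons_none rfl, initialBlock, List.filterMap_append,
      filterMap_replicate rfl, List.filterMap_cons_none rfl, filterMap_replicate rfl]
    rfl
  | succ i ih =>
    obtain ⟨h1, h2, h3⟩ := ih
    obtain ⟨c1, c2, c3⟩ := h1.image N h2
    rw [← List.length_append] at c2
    obtain ⟨u1, u2, u3⟩ := c1.image N c2
    rw [← List.length_append] at u2
    rw [show 2 * (i + 1) = 2 * i + 1 + 1 by ring]
    refine ⟨?_, u2, ?_⟩
    · rw [Function.iterate_succ_apply']
      exact u1
    · simp only [stage]
      rw [List.filterMap_append, List.filterMap_append, h3, c3, u3]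
      rw [outputs_succ, List.append_nil]

/-- There is a non-erasing PD0L word that shows the outputs of a generalized Collatz function. -/
theorem exists_nonErasingPD0LWord [Finite σ] (N : ℕ) :
    ∃ u ∈ NonErasingPD0LWords (CollatzLetter σ),
      ∀ i, ∃ L, (wordTake u L).filterMap shown = T.outputs N i := by
  let S := T.toPD0LSystem N
  -- Stage `n` has more than `n` letters, so the default `start` is never used.
  let u : ℕ → CollatzLetter σ := fun n => (T.stage N n).1.getD n start
  have hpre : ∀ n, (T.stage N n).1 <+: (T.stage N (n + 1)).1 := fun n => List.prefix_append _ _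
  have hu : ∀ n, (T.stage N n).1 = wordTake u (T.stage N n).1.length := by
    intro n
    rw [eq_wordTake_iff rfl]
    intro i hi
    have hi' := (T.lt_length_stage N i).1
    have : (T.stage N n).1[i]? = (T.stage N i).1[i]? := by
      rcases le_total n i with h | h
      · exact getElem?_eq_of_prefix (prefix_chain_le hpre h) hi
      · exact (getElem?_eq_of_prefix (prefix_chain_le hpre h) hi').symm
    rw [this]
    simp [u, List.getElem?_eq_getElem hi', List.getD_eq_getElem?_getD]
  refine ⟨u, ⟨_, inferInstance, Function.Embedding.refl _, S, T.morphism_ne_nil N, ?_⟩, fun i => ?_⟩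
  · refine (convergesToWord_iff S.iterate_prefix).2 ⟨fun n => ?_, fun n => ⟨n, ?_⟩⟩
    · rw [T.iterate_map]
      exact hu n
    · rw [T.iterate_map]
      exact (T.lt_length_stage N n).1.le
  · refine ⟨(T.stage N (2 * i + 1)).1.length, ?_⟩
    rw [← (T.stage_two_mul N i).2.2]
    exact congrArg _ (hu (2 * i + 1)).symm

end CollatzSystem

/-! ### Register machines and generalized Collatz functions -/

/-- The instructions of a register machine with output. -/
inductive Instr (σ : Type) : Type
  | inc (r : ℕ)
  | dec (r : ℕ)
  | emit (a : σ)
  | jz (r t : ℕ)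
  | goto (t : ℕ)

namespace Instr

variable {σ : Type}

/-- The register that is used by an instruction. -/
def reg : Instr σ → ℕ
  | inc r | dec r | jz r _ => r
  | emit _ | goto _ => 0

/-- The program counter after an instruction, given that the instruction is at address `c` and
whether its register is zero. -/
def nextAddr (c : ℕ) (z : Prop) [Decidable z] : Instr σ → ℕ
  | jz _ t => if z then t else c + 1
  | goto t => t
  | _ => c + 1

/-- The effect of an instruction on the registers. -/
def act (s : ℕ → ℕ) : Instr σ → ℕ → ℕ
  | inc r => Function.update s r (s r + 1)
  | dec r => Function.update s r (s r - 1)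
  | _ => s

/-- The letter that is written by an instruction. -/
def written : Instr σ → Option σ
  | emit a => some a
  | _ => none

end Instr

/-- `Steps code c s o c' s'`: the machine gets from address `c` and registers `s` to address `c'`
and registers `s'` and writes `o`. -/
inductive Steps {σ : Type} (code : List (Instr σ)) :
    ℕ → (ℕ → ℕ) → List σ → ℕ → (ℕ → ℕ) → Prop
  | refl (c s) : Steps code c s [] c s
  | head {c s i o c' s'} : code[c]? = some i →
      Steps code (i.nextAddr c (s i.reg = 0)) (i.act s) o c' s' →
      Steps code c s (i.written.toList ++ o) c' s'

theorem Steps.trans {σ : Type} {code : List (Instr σ)} {c₁ c₂ c₃ : ℕ} {s₁ s₂ s₃ : ℕ → ℕ}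
    {o₁ o₂ : List σ} (h₁ : Steps code c₁ s₁ o₁ c₂ s₂) (h₂ : Steps code c₂ s₂ o₂ c₃ s₃) :
    Steps code c₁ s₁ (o₁ ++ o₂) c₃ s₃ := by
  induction h₁ with
  | refl => exact h₂
  | head hi _ ih => rw [List.append_assoc]; exact .head hi (ih h₂)

/-- The register contents `s 0, …, s (R - 1)` as the exponents of the first `R` primes. -/
noncomputable def primeCode (R : ℕ) (s : ℕ → ℕ) : ℕ :=
  ∏ r ∈ Finset.range R, Nat.nth Nat.Prime r ^ s r

theorem prime_nth (r : ℕ) : (Nat.nth Nat.Prime r).Prime := Nat.prime_nth_prime r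

theorem primeCode_update {R r : ℕ} (hr : r < R) (s : ℕ → ℕ) (x : ℕ) :
    primeCode R (Function.update s r x) =
      Nat.nth Nat.Prime r ^ x * ∏ q ∈ (Finset.range R).erase r, Nat.nth Nat.Prime q ^ s q := by
  rw [primeCode, ← Finset.mul_prod_erase _ _ (Finset.mem_range.2 hr), Function.update_self]
  congr 1
  refine Finset.prod_congr rfl fun q hq => ?_
  rw [Function.update_of_ne (Finset.ne_of_mem_erase hq)]

theorem primeCode_eq {R r : ℕ} (hr : r < R) (s : ℕ → ℕ) :
    primeCode R s =
      Nat.nth Nat.Prime r ^ s r * ∏ q ∈ (Finset.range R).erase r, Nat.nth Nat.Prime q ^ s q := by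
  rw [primeCode, ← Finset.mul_prod_erase _ _ (Finset.mem_range.2 hr)]

theorem nth_prime_dvd_primeCode_iff {R r : ℕ} (hr : r < R) (s : ℕ → ℕ) :
    Nat.nth Nat.Prime r ∣ primeCode R s ↔ s r ≠ 0 := by
  have hp := prime_nth r
  constructor
  · intro h h0
    obtain ⟨q, hq, hd⟩ := (hp.prime.dvd_finsetProd_iff _).1 h
    have h1 := (Nat.prime_dvd_prime_iff_eq hp (prime_nth q)).1 (hp.dvd_of_dvd_pow hd)
    have h2 : r = q := Nat.nth_injective Nat.infinite_setOfPred_prime h1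
    subst h2
    rw [h0, pow_zero] at hd
    exact hp.one_lt.ne' (Nat.dvd_one.1 hd)
  · intro h
    exact (dvd_pow_self _ h).trans (Finset.dvd_prod_of_mem _ (Finset.mem_range.2 hr))

namespace Instr

variable {σ : Type}

/-- The effect of an instruction on the prime code of the registers. -/
noncomputable def actCode (M : ℕ) : Instr σ → ℕ
  | inc r => Nat.nth Nat.Prime r * M
  | dec r => if Nat.nth Nat.Prime r ∣ M then M / Nat.nth Nat.Prime r else M
  | _ => M

theorem primeCode_act {R : ℕ} (i : Instr σ) (hi : i.reg < R) (s : ℕ → ℕ) :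
    primeCode R (i.act s) = i.actCode (primeCode R s) := by
  cases i with
  | inc r =>
    have hi' : r < R := hi
    rw [act, actCode, primeCode_update hi', primeCode_eq hi', pow_succ]
    ring
  | dec r =>
    have hi' : r < R := hi
    rw [act, actCode, primeCode_update hi']
    split_ifs with h
    · have h1 := (nth_prime_dvd_primeCode_iff hi' s).1 h
      obtain ⟨x, hx⟩ := Nat.exists_eq_succ_of_ne_zero h1
      rw [primeCode_eq hi', hx, Nat.succ_sub_one, pow_succ, mul_right_comm,
        Nat.mul_div_cancel _ (prime_nth r).pos]
    · have h1 : s r = 0 := by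
        by_contra h1
        exact h ((nth_prime_dvd_primeCode_iff hi' s).2 h1)
      rw [primeCode_eq hi', h1]
  | _ => rfl

/-- On each residue class modulo a common multiple of the primes, the effect of an instruction is
given by an affine function. -/
theorem exists_actCode_eq (i : Instr σ) {D : ℕ} (hD : Nat.nth Nat.Prime i.reg ∣ D) (μ : ℕ) :
    ∃ a b, ∀ q, i.actCode (D * q + μ) = a * q + b := by
  cases i with
  | inc r => exact ⟨Nat.nth Nat.Prime r * D, Nat.nth Nat.Prime r * μ, fun q => by rw [actCode]; ring⟩
  | dec r =>
    have hD' : Nat.nth Nat.Prime r ∣ D := hD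
    obtain ⟨d, rfl⟩ := hD'
    -- As the prime divides `D`, divisibility of `D * q + μ` depends only on `μ`.
    by_cases h : Nat.nth Nat.Prime r ∣ μ
    · obtain ⟨x, rfl⟩ := h
      refine ⟨d, x, fun q => ?_⟩
      rw [actCode, mul_assoc, ← mul_add, if_pos (Dvd.intro _ rfl),
        Nat.mul_div_cancel_left _ (prime_nth r).pos]
    · refine ⟨Nat.nth Nat.Prime r * d, μ, fun q => ?_⟩
      rw [actCode, if_neg]
      rwa [mul_assoc, Nat.dvd_add_right (Dvd.intro _ rfl)]
  | _ => exact ⟨D, μ, fun q => rfl⟩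

end Instr

/-- A register machine program as a generalized Collatz function: the address `c` and the registers
`s` are encoded by the number `code.length * primeCode R s + c`. -/
theorem exists_collatzSystem {σ : Type} (code : List (Instr σ)) (hcode : code ≠ []) :
    ∃ (T : CollatzSystem σ) (R : ℕ), ∀ c s o c' s', Steps code c s o c' s' →
      ∃ n, T.next^[n] (code.length * primeCode R s + c) = code.length * primeCode R s' + c' ∧
        T.outputs (code.length * primeCode R s + c) n = o := by
  classical
  obtain ⟨R, hR⟩ : ∃ R, ∀ i ∈ code, i.reg < R := by
    refine ⟨(code.map Instr.reg).sum + 1, fun i hi => Nat.lt_succ_of_le ?_⟩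
    exact List.le_sum_of_mem (List.mem_map_of_mem hi)
  set Q := code.length with hQ
  have hQpos : 0 < Q := List.length_pos_iff.2 hcode
  -- Modulo `Q * D`, the encoding number reveals the address (its residue modulo `Q`) and which
  -- registers are zero (which primes fail to divide the prime code).
  set D := ∏ r ∈ Finset.range R, Nat.nth Nat.Prime r with hD
  have hDpos : 0 < D := Finset.prod_pos fun r _ => (prime_nth r).pos
  have hdvd : ∀ i ∈ code, Nat.nth Nat.Prime i.reg ∣ D := fun i hi =>
    Finset.dvd_prod_of_mem _ (Finset.mem_range.2 (hR i hi))
  have hex : ∀ ρ, ∃ a b, ∀ i, code[ρ % Q]? = some i → ∀ q,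
      Q * i.actCode (D * q + ρ / Q) +
        i.nextAddr (ρ % Q) (¬ Nat.nth Nat.Prime i.reg ∣ D * q + ρ / Q) = a * q + b := by
    intro ρ
    cases hi : code[ρ % Q]? with
    | none => exact ⟨0, 0, fun i h => by cases h⟩
    | some i =>
      have hm : Nat.nth Nat.Prime i.reg ∣ D := hdvd i (List.mem_of_getElem? hi)
      obtain ⟨a, b, hab⟩ := i.exists_actCode_eq hm (ρ / Q)
      refine ⟨Q * a, Q * b + i.nextAddr (ρ % Q) (¬ Nat.nth Nat.Prime i.reg ∣ ρ / Q), ?_⟩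
      rintro _ ⟨⟩ q
      have hiff : Nat.nth Nat.Prime i.reg ∣ D * q + ρ / Q ↔ Nat.nth Nat.Prime i.reg ∣ ρ / Q :=
        Nat.dvd_add_right (hm.mul_right q)
      rw [hab]
      simp only [hiff]
      ring
  choose a b hab using hex
  let T : CollatzSystem σ :=
    { P := Q * D
      P_pos := Nat.mul_pos hQpos hDpos
      m := a
      k := b
      o := fun ρ => (code[ρ % Q]?).bind Instr.written }
  refine ⟨T, R, fun c s o c' s' h => ?_⟩
  induction h with
  | refl c s => exact ⟨0, rfl, rfl⟩
  | @head c s i o c' s' hi _ ih =>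
    have hc : c < Q := (List.getElem?_eq_some_iff.1 hi).1
    have hmem : i ∈ code := List.mem_of_getElem? hi
    obtain ⟨n, h1, h2⟩ := ih
    set N := Q * primeCode R s + c with hN
    have hNQ : N / Q = primeCode R s := by
      rw [hN, Nat.mul_add_div hQpos, Nat.div_eq_of_lt hc, add_zero]
    have hmod : N % (Q * D) % Q = c := by
      rw [Nat.mod_mul_right_mod, hN, Nat.mul_add_mod, Nat.mod_eq_of_lt hc]
    have hdiv : D * (N / (Q * D)) + N % (Q * D) / Q = primeCode R s := by
      rw [← Nat.div_div_eq_div_mul, Nat.mod_mul_right_div_self, hNQ, Nat.div_add_mod]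
    have hnext : T.next N = Q * primeCode R (i.act s) + i.nextAddr c (s i.reg = 0) := by
      have := hab (N % (Q * D)) i (by rw [hmod]; exact hi) (N / (Q * D))
      rw [hdiv, hmod] at this
      rw [i.primeCode_act (hR i hmem)]
      change a (N % (Q * D)) * (N / (Q * D)) + b (N % (Q * D)) = _
      rw [← this]
      simp only [nth_prime_dvd_primeCode_iff (hR i hmem), not_not]
    have hout : T.output N = i.written := by
      change (code[N % (Q * D) % Q]?).bind Instr.written = _
      rw [hmod, hi]
      rfl
    refine ⟨n + 1, ?_, ?_⟩
    · rw [Function.iterate_succ_apply, hnext, h1]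
    · rw [add_comm n 1, CollatzSystem.outputs_add, Function.iterate_one, hnext, h2,
        CollatzSystem.outputs_succ, Function.iterate_zero_apply, hout]
      rfl

/-! ### While programs -/

/-- While programs over registers, with output. -/
inductive Prog (σ : Type) : Type
  | inc (r : ℕ)
  | dec (r : ℕ)
  | emit (a : σ)
  | seq (p q : Prog σ)
  | loop (r : ℕ) (p : Prog σ)

/-- `Run p s o s'`: on registers `s` the program `p` stops with registers `s'` and writes `o`. -/
inductive Run {σ : Type} : Prog σ → (ℕ → ℕ) → List σ → (ℕ → ℕ) → Prop
  | inc (r s) : Run (.inc r) s [] (Function.update s r (s r + 1))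
  | dec (r s) : Run (.dec r) s [] (Function.update s r (s r - 1))
  | emit (a s) : Run (.emit a) s [a] s
  | seq {p q s₁ s₂ s₃ o₁ o₂} : Run p s₁ o₁ s₂ → Run q s₂ o₂ s₃ → Run (.seq p q) s₁ (o₁ ++ o₂) s₃
  | loop_zero {r p s} : s r = 0 → Run (.loop r p) s [] s
  | loop_succ {r p s₁ s₂ s₃ o₁ o₂} : s₁ r ≠ 0 → Run p s₁ o₁ s₂ → Run (.loop r p) s₂ o₂ s₃ →
      Run (.loop r p) s₁ (o₁ ++ o₂) s₃

namespace Prog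

variable {σ : Type}

def size : Prog σ → ℕ
  | inc _ | dec _ | emit _ => 1
  | seq p q => p.size + q.size
  | loop _ p => p.size + 2

/-- The machine code of a program that is placed at address `b`. -/
def compile : Prog σ → ℕ → List (Instr σ)
  | inc r, _ => [.inc r]
  | dec r, _ => [.dec r]
  | emit a, _ => [.emit a]
  | seq p q, b => p.compile b ++ q.compile (b + p.size)
  | loop r p, b => .jz r (b + p.size + 2) :: (p.compile (b + 1) ++ [.goto b])

@[simp] theorem length_compile (p : Prog σ) (b : ℕ) : (p.compile b).length = p.size := by
  induction p generalizing b with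
  | seq p q hp hq => simp [compile, size, hp, hq]
  | loop r p hp => simp [compile, size, hp]
  | _ => rfl

end Prog

/-- Jump addresses are absolute, so the induction needs arbitrary surrounding code `pre` and `post`,
and the code must be compiled for address `pre.length`. -/
theorem Run.steps {σ : Type} {p : Prog σ} {s s' : ℕ → ℕ} {o : List σ} (h : Run p s o s')
    (pre post : List (Instr σ)) :
    Steps (pre ++ p.compile pre.length ++ post) pre.length s o (pre.length + p.size) s' := by
  induction h generalizing pre post with
  | inc r s => exact Steps.head (i := Instr.inc r) (by simp [Prog.compile]) (.refl _ _)
  | dec r s => exact Steps.head (i := Instr.dec r) (by simp [Prog.compile]) (.refl _ _)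
  | emit a s => exact Steps.head (i := Instr.emit a) (by simp [Prog.compile]) (.refl _ _)
  | @seq p q s₁ s₂ s₃ o₁ o₂ _ _ ih₁ ih₂ =>
    have h₁ := ih₁ pre (q.compile (pre.length + p.size) ++ post)
    have h₂ := ih₂ (pre ++ p.compile pre.length) post
    simp only [List.length_append, Prog.length_compile, List.append_assoc] at h₁ h₂
    simp only [Prog.compile, Prog.size, List.append_assoc, ← add_assoc]
    exact h₁.trans h₂
  | @loop_zero r p s h0 =>
    have hstep := Steps.head (code := pre ++ (Prog.loop r p).compile pre.length ++ post)
      (c := pre.length) (s := s) (i := .jz r (pre.length + p.size + 2)) (by simp [Prog.compile])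
      (.refl _ _)
    simpa [Instr.nextAddr, Instr.act, Instr.reg, Instr.written, h0, Prog.size, add_assoc]
      using hstep
  | @loop_succ r p s₁ s₂ s₃ o₁ o₂ h0 _ _ ih₁ ih₂ =>
    -- One round is the test, the body and the jump back; the remaining rounds start again at the
    -- test by the second hypothesis.
    have h₁ := ih₁ (pre ++ [Instr.jz r (pre.length + p.size + 2)]) (.goto pre.length :: post)
    have h₂ := ih₂ pre post
    have hcode : (pre ++ [Instr.jz r (pre.length + p.size + 2)]) ++
        p.compile (pre ++ [Instr.jz r (pre.length + p.size + 2)]).length ++ Instr.goto pre.length :: post =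
        pre ++ (Prog.loop r p).compile pre.length ++ post := by
      simp [Prog.compile]
    rw [hcode] at h₁
    set code := pre ++ (Prog.loop r p).compile pre.length ++ post
    have hjz : code[pre.length]? = some (Instr.jz r (pre.length + p.size + 2)) := by
      simp [code, Prog.compile]
    have hgoto : code[pre.length + 1 + p.size]? = some (.goto pre.length) := by
      rw [← hcode, List.getElem?_append_right (by simp [add_assoc])]
      simp [add_assoc, add_comm 1]
    have h₃ := Steps.head (s := s₂) hgoto h₂
    have h₄ := Steps.head (s := s₁) hjz (c' := pre.length + 1 + p.size) (s' := s₂) (o := o₁) (by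
      simpa [Instr.nextAddr, Instr.act, Instr.reg, h0] using h₁)
    exact h₄.trans h₃

/-! ### Clearing, counted loops and copying -/

namespace Prog

variable {σ : Type}

/-- Set the register `r` to zero. -/
def clear (r : ℕ) : Prog σ := loop r (dec r)

theorem run_clear (r : ℕ) (s : ℕ → ℕ) : Run (clear r : Prog σ) s [] (Function.update s r 0) := by
  generalize hn : s r = n
  induction n generalizing s with
  | zero =>
    have : Function.update s r 0 = s := by rw [← hn, Function.update_eq_self]
    rw [this]
    exact .loop_zero hn
  | succ n ih =>
    have h := ih (Function.update s r (s r - 1)) (by simp [hn])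
    rw [Function.update_idem] at h
    exact .loop_succ (by omega) (.dec r s) h

/-- A loop that decreases its counter by one in each round runs as often as the counter says. -/
theorem exists_run_loop {r : ℕ} {p : Prog σ} {I : ℕ → (ℕ → ℕ) → Prop}
    (hI : ∀ n s, I n s → s r = n)
    (hp : ∀ n s, I (n + 1) s → ∃ s', Run p s [] s' ∧ I n s') (n : ℕ) (s : ℕ → ℕ) (hs : I n s) :
    ∃ s', Run (loop r p) s [] s' ∧ I 0 s' := by
  induction n generalizing s with
  | zero => exact ⟨s, .loop_zero (hI 0 s hs), hs⟩
  | succ n ih =>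
    obtain ⟨s₁, h₁, hs₁⟩ := hp n s hs
    obtain ⟨s₂, h₂, hs₂⟩ := ih s₁ hs₁
    exact ⟨s₂, .loop_succ (by rw [hI _ s hs]; omega) h₁ h₂, hs₂⟩

/-- Copy the register `a` to the register `b`, using the register `t`. -/
def copy (a b t : ℕ) : Prog σ :=
  seq (clear b) (seq (clear t) (seq (loop a (seq (dec a) (seq (inc b) (inc t))))
    (loop t (seq (dec t) (inc a)))))

theorem exists_run_copy {a b t : ℕ} (hab : a ≠ b) (hat : a ≠ t) (hbt : b ≠ t) (s : ℕ → ℕ) :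
    ∃ s', Run (copy a b t : Prog σ) s [] s' ∧ s' b = s a ∧ ∀ r, r ≠ b → r ≠ t → s' r = s r := by
  let s₀ := Function.update (Function.update s b 0) t 0
  -- This loop drains `a` into both `b` and `t`; the next one restores `a` from `t`.
  obtain ⟨s₁, h₁, ha₁, hb₁, ht₁, ho₁⟩ := exists_run_loop (σ := σ) (r := a)
    (p := seq (dec a) (seq (inc b) (inc t)))
    (I := fun n s' => s' a = n ∧ s' b + n = s a ∧ s' t + n = s a ∧
      ∀ r, r ≠ a → r ≠ b → r ≠ t → s' r = s r)
    (fun n s' h => h.1) (fun n s' ⟨h1, h2, h3, h4⟩ =>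
      ⟨_, .seq (.dec _ _) (.seq (.inc _ _) (.inc _ _)), by
        simp only [Function.update_apply]
        refine ⟨?_, ?_, ?_, ?_⟩
        · simp [hab, hat, h1]
        · simp [hab.symm, hbt]; omega
        · simp [hat.symm, hbt.symm]; omega
        · intro r ha hb ht
          simp [ha, hb, ht, h4]⟩)
    (s a) s₀ (by
      simp only [s₀, Function.update_apply]
      refine ⟨?_, ?_, ?_, ?_⟩
      · simp [hab, hat]
      · simp
      · simp
      · intro r _ hb ht
        simp [hb, ht])
  obtain ⟨s₂, h₂, ht₂, ha₂, ho₂⟩ := exists_run_loop (σ := σ) (r := t) (p := seq (dec t) (inc a))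
    (I := fun n s' => s' t = n ∧ s' a + n = s a ∧ ∀ r, r ≠ a → r ≠ t → s' r = s₁ r)
    (fun n s' h => h.1) (fun n s' ⟨h1, h2, h3⟩ =>
      ⟨_, .seq (.dec _ _) (.inc _ _), by
        simp only [Function.update_apply]
        refine ⟨?_, ?_, ?_⟩
        · simp [hat.symm, h1]
        · simp [hat]; omega
        · intro r ha ht
          simp [ha, ht, h3]⟩)
    (s a) s₁ ⟨by omega, by omega, fun _ _ _ => rfl⟩
  refine ⟨s₂, .seq (run_clear b s) (.seq (run_clear t _) (.seq h₁ h₂)), ?_, ?_⟩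
  · rw [ho₂ b hab.symm hbt]
    omega
  · intro r hb ht
    by_cases ha : r = a
    · subst ha
      omega
    · rw [ho₂ r ha ht, ho₁ r ha hb ht]

end Prog

/-- The function `f` is computed by programs that read its arguments from given registers and write
its value to a given other one, and that do not change any other registers below a given bound. -/
def Implementable (σ : Type) {n : ℕ} (f : List.Vector ℕ n → ℕ) : Prop :=
  ∀ (ins : Fin n → ℕ) (out B : ℕ), (∀ i, ins i < B) → (∀ i, ins i ≠ out) → out < B →
    ∃ p : Prog σ, ∀ s, ∃ s', Run p s [] s' ∧
      s' out = f (List.Vector.ofFn fun i => s (ins i)) ∧ ∀ r < B, r ≠ out → s' r = s r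

open Prog in
-- Scratch registers are taken from `B` on; programs for the constituents get a larger bound, so
-- they preserve the values stored there.
theorem implementable_of_primrec' (σ : Type) {n : ℕ} {f : List.Vector ℕ n → ℕ}
    (hf : Nat.Primrec' f) : Implementable σ f := by
  induction hf with
  | zero =>
    intro ins out B _ _ _
    refine ⟨clear out, fun s => ⟨_, run_clear out s, by simp, fun r _ hr => by simp [hr]⟩⟩
  | succ =>
    intro ins out B hins hne hout
    refine ⟨seq (copy (ins 0) out B) (inc out), fun s => ?_⟩
    obtain ⟨s', h, h1, h2⟩ := exists_run_copy (σ := σ) (hne 0) (hins 0).ne hout.ne s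
    refine ⟨_, .seq h (.inc _ _), by simp [h1], fun r hrB hr => ?_⟩
    simp [hr, h2 r hr hrB.ne]
  | get i =>
    intro ins out B hins hne hout
    refine ⟨copy (ins i) out B, fun s => ?_⟩
    obtain ⟨s', h, h1, h2⟩ := exists_run_copy (σ := σ) (hne i) (hins i).ne hout.ne s
    exact ⟨s', h, by simp [h1], fun r hrB hr => h2 r hr hrB.ne⟩
  | @comp m n f g _ _ ihf ihg =>
    intro ins out B hins hne hout
    -- The values of the inner functions are collected one by one in the registers `B, …, B + n -
    -- 1`.
    have key : ∀ k ≤ n, ∃ p : Prog σ, ∀ s, ∃ s', Run p s [] s' ∧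
        (∀ i : Fin n, i.val < k → s' (B + i) = g i (List.Vector.ofFn fun i => s (ins i))) ∧
        ∀ r < B, s' r = s r := by
      intro k
      induction k with
      | zero =>
        refine fun _ => ⟨clear B, fun s => ⟨_, run_clear B s, fun i hi => absurd hi (by omega),
          fun r hr => by simp [hr.ne]⟩⟩
      | succ k ih =>
        intro hk
        obtain ⟨p, hp⟩ := ih (by omega)
        obtain ⟨q, hq⟩ := ihg ⟨k, hk⟩ ins (B + k) (B + n) (fun i => by have := hins i; omega)
          (fun i => by have := hins i; omega) (by omega)
        refine ⟨seq p q, fun s => ?_⟩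
        obtain ⟨s₁, h₁, hv₁, ho₁⟩ := hp s
        obtain ⟨s₂, h₂, hv₂, ho₂⟩ := hq s₁
        refine ⟨s₂, .seq h₁ h₂, fun i hi => ?_, fun r hr => ?_⟩
        · by_cases hik : i.val = k
          · have : i = ⟨k, hk⟩ := Fin.ext hik
            subst this
            rw [hv₂]
            congr 2
            funext j
            exact ho₁ _ (hins j)
          · rw [ho₂ _ (by omega) (by omega), hv₁ i (by omega)]
        · rw [ho₂ r (by omega) (by omega), ho₁ r hr]
    obtain ⟨p, hp⟩ := key n le_rfl
    obtain ⟨q, hq⟩ := ihf (fun i => B + i) out (B + n) (fun i => by omega) (fun i => by omega)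
      (by omega)
    refine ⟨seq p q, fun s => ?_⟩
    obtain ⟨s₁, h₁, hv₁, ho₁⟩ := hp s
    obtain ⟨s₂, h₂, hv₂, ho₂⟩ := hq s₁
    refine ⟨s₂, .seq h₁ h₂, ?_, fun r hr hro => ?_⟩
    · rw [hv₂]
      congr 2
      funext i
      exact hv₁ i i.isLt
    · rw [ho₂ r (by omega) hro, ho₁ r hr]
  | @prec n f g _ _ ihf ihg =>
    intro ins out B hins hne hout
    have hinsT : ∀ i : Fin n, ins i.succ < B := fun i => hins _
    -- counter `B`, index `B + 1`, accumulator `B + 2`, new value `B + 3`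
    obtain ⟨pf, hpf⟩ := ihf (fun i => ins i.succ) (B + 2) (B + 4)
      (fun i => by have := hinsT i; omega) (fun i => by have := hinsT i; omega) (by omega)
    obtain ⟨pg, hpg⟩ := ihg (Fin.cons (B + 1) (Fin.cons (B + 2) fun i => ins i.succ)) (B + 3) (B + 4)
      (by
        refine Fin.cases (by simp) (Fin.cases (by simp) fun i => ?_)
        have := hinsT i
        simp only [Fin.cons_succ]; omega)
      (by
        refine Fin.cases (by simp) (Fin.cases (by simp) fun i => ?_)
        have := hinsT i
        simp only [Fin.cons_succ]; omega)
      (by omega)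
    refine ⟨seq pf (seq (copy (ins 0) B (B + 4)) (seq (clear (B + 1))
      (seq (loop B (seq pg (seq (copy (B + 3) (B + 2) (B + 4)) (seq (inc (B + 1)) (dec B)))))
        (copy (B + 2) out (B + 4))))), fun s => ?_⟩
    have h0B := hins 0
    obtain ⟨s₁, h₁, hv₁, ho₁⟩ := hpf s
    obtain ⟨s₂, h₂, hv₂, ho₂⟩ := exists_run_copy (σ := σ) (a := ins 0) (b := B) (t := B + 4)
      (by omega) (by omega) (by omega) s₁
    set v : List.Vector ℕ n := List.Vector.ofFn fun i => s (ins i.succ) with hv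
    let F : ℕ → ℕ := fun y => Nat.rec (f v) (fun y IH => g (y ::ᵥ IH ::ᵥ v)) y
    have hinit : Function.update s₂ (B + 1) 0 B = s (ins 0) ∧
        Function.update s₂ (B + 1) 0 (B + 1) + s (ins 0) = s (ins 0) ∧
        Function.update s₂ (B + 1) 0 (B + 2) = F (Function.update s₂ (B + 1) 0 (B + 1)) ∧
        ∀ r < B, Function.update s₂ (B + 1) 0 r = s r := by
      refine ⟨?_, ?_, ?_, ?_⟩
      · rw [Function.update_of_ne (by omega), hv₂, ho₁ _ (by omega) (by omega)]
      · simp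
      · rw [Function.update_of_ne (by omega), ho₂ _ (by omega) (by omega), hv₁]
        simp [F, hv]
      · intro r hr
        rw [Function.update_of_ne (by omega), ho₂ _ (by omega) (by omega),
          ho₁ r (by omega) (by omega)]
    obtain ⟨s₃, h₃, hB₃, hi₃, ha₃, ho₃⟩ := exists_run_loop (σ := σ) (r := B)
      (p := seq pg (seq (copy (B + 3) (B + 2) (B + 4)) (seq (inc (B + 1)) (dec B))))
      (I := fun y s' => s' B = y ∧ s' (B + 1) + y = s (ins 0) ∧ s' (B + 2) = F (s' (B + 1)) ∧
        ∀ r < B, s' r = s r)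
      (fun n s' h => h.1) (fun y t ⟨e1, e2, e3, e4⟩ => by
        obtain ⟨t₁, k₁, w₁, z₁⟩ := hpg t
        obtain ⟨t₂, k₂, w₂, z₂⟩ := exists_run_copy (σ := σ) (a := B + 3) (b := B + 2) (t := B + 4)
          (by omega) (by omega) (by omega) t₁
        have hw : t₁ (B + 3) = F (t (B + 1) + 1) := by
          rw [w₁]
          change _ = g (t (B + 1) ::ᵥ F (t (B + 1)) ::ᵥ v)
          rw [← e3, hv]
          congr 1
          simp only [List.Vector.ofFn, Fin.cons_zero, Fin.cons_succ]
          congr 3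
          funext i
          exact e4 _ (hinsT i)
        have hB : t₂ B = y + 1 := by
          rw [z₂ B (by omega) (by omega), z₁ B (by omega) (by omega), e1]
        have hB1 : t₂ (B + 1) = t (B + 1) := by
          rw [z₂ _ (by omega) (by omega), z₁ _ (by omega) (by omega)]
        refine ⟨_, .seq k₁ (.seq k₂ (.seq (.inc _ _) (.dec _ _))), ?_, ?_, ?_, ?_⟩
        · simp [hB]
        · simp [hB1]; omega
        · simp [hB1, w₂, hw]
        · intro r hr
          rw [Function.update_of_ne (by omega), Function.update_of_ne (by omega),
            z₂ r (by omega) (by omega), z₁ r (by omega) (by omega), e4 r hr])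
      (s (ins 0)) (Function.update s₂ (B + 1) 0) hinit
    obtain ⟨s₄, h₄, hv₄, ho₄⟩ := exists_run_copy (σ := σ) (a := B + 2) (b := out) (t := B + 4)
      (by omega) (by omega) (by omega) s₃
    refine ⟨s₄, .seq h₁ (.seq h₂ (.seq (run_clear _ _) (.seq h₃ h₄))), ?_, fun r hr hro => ?_⟩
    · rw [hv₄, ha₃, show s₃ (B + 1) = s (ins 0) by omega]
      rfl
    · rw [ho₄ r hro (by omega), ho₃ r hr]

/-! ### Computable words are erasures of PD0L words -/

/-- The letters of a computable word are output one after the other by a primitive recursive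
function of the time. -/
theorem exists_primrec_schedule {K : ℕ} {w : ℕ → Fin K} (hw : Computable w) :
    ∃ o : ℕ → Option (Fin K), Primrec o ∧
      ∀ n, ∃ y, (List.range y).filterMap o = wordTake w n := by
  have hval : Computable fun n => Encodable.encode (w n) := Computable.encode.comp hw
  obtain ⟨c, hc⟩ := Nat.Partrec.Code.exists_code.1 (Partrec.nat_iff.1 hval)
  have hc' : ∀ n, c.eval n = Part.some (Encodable.encode (w n)) := fun n => congrFun hc n
  -- `G (n, t)` tries to compute the letter at `n` with budget `t`; bounded evaluation keeps it
  -- primitive recursive.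
  let G : ℕ × ℕ → Option (Fin K) := fun x =>
    (Nat.Partrec.Code.evaln x.2 c x.1).bind Encodable.decode
  have hGprim : Primrec G := by
    have h1 : Primrec fun x : ℕ × ℕ => Nat.Partrec.Code.evaln x.2 c x.1 :=
      Nat.Partrec.Code.primrec_evaln.comp
        (Primrec.pair (Primrec.pair Primrec.snd (Primrec.const c)) Primrec.fst)
    exact Primrec.option_bind h1 (Primrec.decode.comp Primrec.snd).to₂
  have hGsound : ∀ n t a, G (n, t) = some a → a = w n := by
    intro n t a h
    obtain ⟨v, hv, hd⟩ := Option.bind_eq_some_iff.1 h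
    have h1 := Nat.Partrec.Code.evaln_sound hv
    rw [hc', Part.mem_some_iff] at h1
    rw [h1, Encodable.encodek] at hd
    exact (Option.some.inj hd).symm
  have hGcomplete : ∀ n, ∃ t, G (n, t) = some (w n) := by
    intro n
    have h1 : Encodable.encode (w n) ∈ c.eval n := by rw [hc']; exact Part.mem_some _
    obtain ⟨t, ht⟩ := Nat.Partrec.Code.evaln_complete.1 h1
    refine ⟨t, ?_⟩
    change (Nat.Partrec.Code.evaln t c n).bind _ = _
    rw [Option.mem_def.1 ht, Option.bind_some, Encodable.encodek]
  -- Raise the budget after a failure; after a success pass to the next letter with budget `0`.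
  let next : ℕ × ℕ → ℕ × ℕ := fun x => (G x).elim (x.1, x.2 + 1) fun _ => (x.1 + 1, 0)
  have hnext : Primrec next := by
    refine (Primrec.option_casesOn (f := fun x : ℕ × ℕ => (x.1, x.2 + 1))
      (g := fun x (_ : Fin K) => (x.1 + 1, 0)) hGprim
      (Primrec.pair Primrec.fst (Primrec.succ.comp Primrec.snd))
      (Primrec.pair (Primrec.succ.comp (Primrec.fst.comp Primrec.fst)) (Primrec.const 0)).to₂).of_eq
      fun x => ?_
    dsimp only [next]
    cases G x <;> rfl
  have hit : Primrec fun y : ℕ => next^[y] (0, 0) :=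
    Primrec.nat_iterate Primrec.id (Primrec.const (0, 0)) (hnext.comp Primrec.snd).to₂
  refine ⟨fun y => G (next^[y] (0, 0)), hGprim.comp hit, ?_⟩
  -- The induction is on the budget `d` still missing; an earlier success is harmless, since by
  -- soundness it gives the same letter.
  have hadvance : ∀ d n t y, next^[y] (0, 0) = (n, t) → G (n, t + d) = some (w n) →
      ∃ y', next^[y'] (0, 0) = (n + 1, 0) ∧
        (List.range y').filterMap (fun y => G (next^[y] (0, 0))) =
          (List.range y).filterMap (fun y => G (next^[y] (0, 0))) ++ [w n] := by
    intro d
    induction d with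
    | zero =>
      intro n t y hy hG
      rw [add_zero] at hG
      refine ⟨y + 1, ?_, ?_⟩
      · rw [Function.iterate_succ_apply', hy]
        simp [next, hG]
      · rw [filterMap_range_succ, hy, hG]
        rfl
    | succ d ih =>
      intro n t y hy hG
      cases hGt : G (n, t) with
      | some a =>
        obtain rfl := hGsound n t a hGt
        refine ⟨y + 1, ?_, ?_⟩
        · rw [Function.iterate_succ_apply', hy]
          simp [next, hGt]
        · rw [filterMap_range_succ, hy, hGt]
          rfl
      | none =>
        obtain ⟨y', h1, h2⟩ := ih n (t + 1) (y + 1)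
          (by rw [Function.iterate_succ_apply', hy]; simp [next, hGt])
          (by rw [← hG, add_assoc, add_comm 1 d])
        refine ⟨y', h1, ?_⟩
        rw [h2, filterMap_range_succ, hy, hGt]
        simp
  have key : ∀ n, ∃ y, next^[y] (0, 0) = (n, 0) ∧
      (List.range y).filterMap (fun y => G (next^[y] (0, 0))) = wordTake w n := by
    intro n
    induction n with
    | zero => exact ⟨0, rfl, rfl⟩
    | succ n ih =>
      obtain ⟨y, h1, h2⟩ := ih
      obtain ⟨t, ht⟩ := hGcomplete n
      obtain ⟨y', h3, h4⟩ := hadvance t n 0 y h1 (by rwa [zero_add])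
      exact ⟨y', h3, by rw [h4, h2, wordTake_succ]⟩
  exact fun n => (key n).imp fun y h => h.2

theorem filter_finRange_eq {K : ℕ} (x : Option (Fin K)) :
    (List.finRange K).filter (fun a => x = some a) = x.toList := by
  cases x with
  | none => simp
  | some b =>
    have h : (fun a => decide (some b = some a)) = fun a : Fin K => a == b := by
      funext a
      by_cases hab : a = b
      · simp [hab]
      · simp [hab, Ne.symm hab]
    rw [h, List.filter_beq, List.count_eq_one_of_mem (List.nodup_finRange K) (List.mem_finRange b)]
    rfl

/-- A program that writes the value of a primitive recursive function of the register `0`. -/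
theorem exists_prog_of_primrec {K : ℕ} {o : ℕ → Option (Fin K)} (ho : Primrec o) :
    ∃ p : Prog (Fin K), ∀ s, ∃ s', Run p s (o (s 0)).toList s' ∧ s' 0 = s 0 := by
  have key : ∀ l : List (Fin K), ∃ p : Prog (Fin K), ∀ s, ∃ s',
      Run p s (l.filter fun a => o (s 0) = some a) s' ∧ s' 0 = s 0 := by
    intro l
    induction l with
    -- Clearing the scratch register `1` serves as an empty program.
    | nil => exact ⟨Prog.clear 1, fun s => ⟨_, Prog.run_clear 1 s, by simp⟩⟩
    | cons a l ih =>
      obtain ⟨q, hq⟩ := ih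
      have hind : Primrec fun y => if o y = some a then 1 else 0 :=
        Primrec.ite (Primrec.eq.comp ho (Primrec.const (some a))) (Primrec.const 1)
          (Primrec.const 0)
      -- The indicator of `o y = a` goes into register `1`, so that the loop on it emits `a` once or
      -- not at all.
      obtain ⟨p, hp⟩ := implementable_of_primrec' (Fin K) (Nat.Primrec'.prim_iff₁.2 hind)
        (fun _ => 0) 1 2 (fun _ => by omega) (fun _ => by omega) (by omega)
      refine ⟨.seq (.seq p (.loop 1 (.seq (.emit a) (.dec 1)))) q, fun s => ?_⟩
      obtain ⟨s₁, h₁, hv₁, ho₁⟩ := hp s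
      have h01 : s₁ 0 = s 0 := ho₁ 0 (by omega) (by omega)
      have hv : s₁ 1 = if o (s 0) = some a then 1 else 0 := by
        rw [hv₁]
        simp
      obtain ⟨s₂, h₂, h02⟩ : ∃ s₂, Run (.loop 1 (.seq (.emit a) (.dec 1))) s₁
          (if o (s 0) = some a then [a] else []) s₂ ∧ s₂ 0 = s₁ 0 := by
        split_ifs with h
        · rw [if_pos h] at hv
          refine ⟨_, .loop_succ (by omega) (.seq (.emit a s₁) (.dec 1 s₁)) (.loop_zero ?_), ?_⟩
          · simp [hv]
          · simp
        · rw [if_neg h] at hv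
          exact ⟨s₁, .loop_zero hv, rfl⟩
      obtain ⟨s₃, h₃, h03⟩ := hq s₂
      have h20 : s₂ 0 = s 0 := h02.trans h01
      refine ⟨s₃, ?_, h03.trans h20⟩
      have := Run.seq (.seq h₁ h₂) h₃
      rw [h20] at this
      rw [List.filter_cons]
      by_cases h : o (s 0) = some a
      · simpa [h] using this
      · simpa [h] using this
  obtain ⟨p, hp⟩ := key (List.finRange K)
  exact ⟨p, fun s => by simpa only [filter_finRange_eq] using hp s⟩

/-- Every computable word is obtained from a non-erasing PD0L word by erasing letters. -/
theorem exists_nonErasingPD0LWord_of_computable {K : ℕ} {w : ℕ → Fin K} (hw : Computable w) :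
    ∃ u ∈ NonErasingPD0LWords (CollatzLetter (Fin K)),
      ∀ n, ∃ L, (wordTake u L).filterMap CollatzLetter.shown = wordTake w n := by
  obtain ⟨o, ho, how⟩ := exists_primrec_schedule hw
  obtain ⟨p, hp⟩ := exists_prog_of_primrec ho
  let q : Prog (Fin K) := .seq p (.inc 0)
  -- The machine repeats forever, with register `0` as the clock.
  let code := q.compile 0 ++ [Instr.goto 0]
  have hround : ∀ s, ∃ s', Steps code 0 s (o (s 0)).toList 0 s' ∧ s' 0 = s 0 + 1 := by
    intro s
    obtain ⟨s₁, h₁, h01⟩ := hp s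
    have hrun : Run q s ((o (s 0)).toList ++ []) _ := .seq h₁ (.inc 0 s₁)
    have hsteps := hrun.steps [] [Instr.goto 0]
    have hgoto : code[0 + q.size]? = some (Instr.goto 0) := by
      rw [List.getElem?_append_right (by simp)]
      simp
    have := hsteps.trans (.head hgoto (.refl _ _))
    refine ⟨Function.update s₁ 0 (s₁ 0 + 1), ?_, by simp [h01]⟩
    simpa [Instr.act, Instr.nextAddr, Instr.written] using this
  have hall : ∀ y, ∃ s, Steps code 0 (fun _ => 0) ((List.range y).filterMap o) 0 s ∧ s 0 = y := by
    intro y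
    induction y with
    | zero => exact ⟨_, .refl _ _, rfl⟩
    | succ y ih =>
      obtain ⟨s, h, hs⟩ := ih
      obtain ⟨s', h', hs'⟩ := hround s
      rw [hs] at h' hs'
      exact ⟨s', by rw [filterMap_range_succ]; exact h.trans h', hs'⟩
  obtain ⟨T, R, hT⟩ := exists_collatzSystem code (by simp [code])
  obtain ⟨u, hu, hout⟩ := T.exists_nonErasingPD0LWord (code.length * primeCode R (fun _ => 0) + 0)
  refine ⟨u, hu, fun n => ?_⟩
  obtain ⟨y, hy⟩ := how n
  obtain ⟨s, hs, -⟩ := hall y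
  obtain ⟨i, -, hi⟩ := hT _ _ _ _ _ hs
  obtain ⟨L, hL⟩ := hout i
  exact ⟨L, by rw [hL, hi, hy]⟩

theorem filterMap_wordTake_succ {α β : Type} (f : α → Option β) (u : ℕ → α) (n : ℕ) :
    (wordTake u (n + 1)).filterMap f = (wordTake u n).filterMap f ++ (f (u n)).toList := by
  rw [wordTake_succ, List.filterMap_append, List.filterMap_cons, List.filterMap_nil]
  cases f (u n) <;> rfl

/-- A transducer with one state suffices: it only drops the letters that show no output and renames
the others. -/
theorem computableWords_subset_transductionsOf (β : Type) :
    ComputableWords β ⊆ transductionsOf NonErasingPD0LWords β := by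
  rintro w ⟨K, e, hw⟩
  obtain ⟨u, hu, hL⟩ := exists_nonErasingPD0LWord_of_computable hw
  let T : Transducer (CollatzLetter (Fin K)) β Unit :=
    { start := (), step := fun _ _ => (), out := fun _ x => (x.shown.toList).map e.symm }
  have hout : ∀ n, T.output u n = ((wordTake u n).filterMap CollatzLetter.shown).map e.symm := by
    intro n
    induction n with
    | zero => rfl
    | succ n ih => rw [T.output_succ, ih, filterMap_wordTake_succ, List.map_append]
  have hex : ∀ n, ∃ L, T.output u L = wordTake w n := by
    intro n
    obtain ⟨L, h⟩ := hL n
    refine ⟨L, ?_⟩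
    rw [hout, h, wordTake, List.map_map]
    exact List.map_congr_left fun i _ => e.symm_apply_apply (w i)
  refine ⟨_, inferInstance, Unit, inferInstance, T, u, hu, (T.transduces_iff u w).2 ⟨?_, ?_⟩⟩
  · intro n
    -- The extra letter forces the output at `L` to come after the one at `n`, which is thus a
    -- prefix of a prefix of `w`.
    obtain ⟨L, h⟩ := hex ((T.output u n).length + 1)
    have hchain : ∀ m, T.output u m <+: T.output u (m + 1) := fun m => by
      rw [T.output_succ]; exact List.prefix_append _ _
    have hnL : n ≤ L := by
      by_contra hlt
      have h1 := (prefix_chain_le hchain (not_le.1 hlt).le).length_le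
      rw [h, length_wordTake] at h1
      omega
    have h1 := prefix_chain_le hchain hnL
    rw [h] at h1
    exact eq_wordTake_of_prefix h1
  · intro N
    obtain ⟨L, h⟩ := hex N
    exact ⟨L, by rw [h, length_wordTake]⟩

/-! ### Erasing letters -/

/-- The positions of the letters on which `f` is defined, when `f` maps prefixes of `u` to prefixes
of `w` of every length. -/
theorem exists_strictMono_of_filterMap_wordTake {α β : Type} {f : α → Option β} {u : ℕ → α}
    {w : ℕ → β} (h : ∀ n, ∃ L, (wordTake u L).filterMap f = wordTake w n) :
    ∃ φ : ℕ → ℕ, StrictMono φ ∧ Set.range φ = {i | f (u i) ≠ none} ∧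
      ∀ n, f (u (φ n)) = some (w n) := by
  classical
  let q : ℕ → Prop := fun i => f (u i) ≠ none
  have hlen : ∀ L, ((wordTake u L).filterMap f).length = Nat.count q L := by
    intro L
    induction L with
    | zero => rfl
    | succ L ih =>
      rw [filterMap_wordTake_succ, List.length_append, ih, Nat.count_succ]
      by_cases hL : q L
      · obtain ⟨a, ha⟩ := Option.ne_none_iff_exists'.1 hL
        rw [if_pos hL, ha]
        rfl
      · rw [if_neg hL, not_not.1 hL]
        rfl
  have hcount : ∀ n, ∃ L, Nat.count q L = n ∧ (wordTake u L).filterMap f = wordTake w n := by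
    intro n
    obtain ⟨L, hL⟩ := h n
    exact ⟨L, by rw [← hlen, hL, length_wordTake], hL⟩
  have hinf : (Set.ofPred q).Infinite := by
    intro hfin
    obtain ⟨L, hL, -⟩ := hcount (hfin.toFinset.card + 1)
    have : Nat.count q L ≤ hfin.toFinset.card := by
      rw [Nat.count_eq_card_filter_range]
      refine Finset.card_le_card fun i hi => ?_
      rw [Set.Finite.mem_toFinset]
      exact (Finset.mem_filter.1 hi).2
    omega
  have hq : ∀ n, q (Nat.nth q n) := fun n => Nat.nth_mem_of_infinite hinf n
  refine ⟨Nat.nth q, Nat.nth_strictMono hinf, Nat.range_nth_of_infinite hinf, ?_⟩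
  choose v hv using fun n => Option.ne_none_iff_exists'.1 (hq n)
  have hpre : ∀ L, (wordTake u L).filterMap f = wordTake v (Nat.count q L) := by
    intro L
    induction L with
    | zero => rfl
    | succ L ih =>
      rw [filterMap_wordTake_succ, ih, Nat.count_succ]
      by_cases hL : q L
      · have := hv (Nat.count q L)
        rw [Nat.nth_count hL] at this
        rw [if_pos hL, wordTake_succ, this]
        rfl
      · rw [if_neg hL, not_not.1 hL]
        simp
  intro n
  obtain ⟨L, hL, hLw⟩ := hcount (n + 1)
  have h1 := (hpre L).symm.trans hLw
  rw [hL] at h1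
  have h2 := getElem?_wordTake v (Nat.lt_succ_self n)
  rw [h1, getElem?_wordTake w (Nat.lt_succ_self n)] at h2
  rw [hv, h2]

/-- A class closed under erasing one letter is closed under erasing finitely many letters. -/
theorem ClosedUnderErasingLetters.comp_mem {C : WordClass} (hC : ClosedUnderErasingLetters C)
    {α : Type} [Finite α] {u : ℕ → α} (hu : u ∈ C α) (A : Finset α) {φ : ℕ → ℕ}
    (hφ : StrictMono φ) (hr : Set.range φ = {i | u i ∉ A}) : u ∘ φ ∈ C α := by
  classical
  induction A using Finset.induction_on generalizing φ with
  | empty =>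
    have : φ = id := by
      rw [← StrictMono.range_inj hφ strictMono_id, hr]
      simp
    simpa [this] using hu
  | insert a A _ ih =>
    have hinf : {i | u i ∉ A}.Infinite := by
      refine (Set.infinite_range_of_injective hφ.injective).mono ?_
      rw [hr]
      exact fun i hi hA => hi (Finset.mem_insert_of_mem hA)
    -- `ψ` lists the positions that survive the erasure of `A`. Then `φ` factors as `ψ ∘ θ`, where
    -- `θ` erases the one further letter `a`.
    have hψ := Nat.nth_strictMono hinf
    have hψr := Nat.range_nth_of_infinite hinf
    set ψ := Nat.nth fun i => u i ∉ A
    have hmem : ∀ n, ∃ m, ψ m = φ n := by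
      intro n
      have h1 : φ n ∈ Set.range φ := ⟨n, rfl⟩
      rw [hr] at h1
      have h2 : φ n ∈ Set.range ψ := by
        rw [hψr]
        exact fun hA => h1 (Finset.mem_insert_of_mem hA)
      exact h2
    choose θ hθ using hmem
    refine hC α a (u ∘ ψ) (u ∘ φ) (ih hψ hψr) ⟨θ, fun m n hmn => ?_, ?_, fun n => ?_⟩
    · rw [← hψ.lt_iff_lt, hθ, hθ]
      exact hφ hmn
    · ext m
      constructor
      · rintro ⟨n, rfl⟩
        have h1 : φ n ∈ Set.range φ := ⟨n, rfl⟩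
        rw [hr] at h1
        change u (ψ (θ n)) ≠ a
        rw [hθ]
        exact fun ha => h1 (ha ▸ Finset.mem_insert_self a A)
      · intro hm
        have h1 : ψ m ∈ Set.range ψ := ⟨m, rfl⟩
        rw [hψr] at h1
        have h2 : ψ m ∈ Set.range φ := by
          rw [hr]
          intro hmem
          rcases Finset.mem_insert.1 hmem with h | h
          · exact hm h
          · exact h1 h
        obtain ⟨n, hn⟩ := h2
        exact ⟨n, hψ.injective ((hθ n).trans hn)⟩
    · simp [hθ]

/-! ### Failure of closure, for any class between the two -/

theorem not_closedUnderErasingLetters {C : WordClass} (h₁ : ∀ α, NonErasingPD0LWords α ⊆ C α)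
    (h₂ : ∀ α, C α ⊆ PD0LWords α) : ¬ ClosedUnderErasingLetters C := by
  classical
  intro hC
  obtain ⟨u, hu, hL⟩ := exists_nonErasingPD0LWord_of_computable factorialWord_computable
  obtain ⟨φ, hφ, hr, hφw⟩ := exists_strictMono_of_filterMap_wordTake hL
  have := Fintype.ofFinite (CollatzLetter (Fin 2))
  have hmem := hC.comp_mem (h₁ _ hu)
    (Finset.univ.filter fun x : CollatzLetter (Fin 2) => x.shown = none) hφ (by
      rw [hr]
      ext i
      simp)
  obtain ⟨β, hβ, ι, S, hS⟩ := h₂ _ hmem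
  -- The surviving letters are `out a`, so composing with the injective `out` embeds the alphabet of
  -- the factorial word into that of the system.
  refine factorialWord_notMem_PD0LWords ⟨β, hβ,
    ⟨fun a => ι (CollatzLetter.out a), fun a b hab => CollatzLetter.out.inj (ι.injective hab)⟩,
    S, ?_⟩
  have : (fun n => ι ((u ∘ φ) n)) = fun n => ι (CollatzLetter.out (factorialWord n)) := by
    funext n
    rw [Function.comp_apply, CollatzLetter.shown_eq_some_iff.1 (hφw n)]
  rw [this] at hS
  exact hS

theorem not_closedUnderTransductions {C : WordClass} (h₁ : ∀ α, NonErasingPD0LWords α ⊆ C α)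
    (h₂ : ∀ α, C α ⊆ PD0LWords α) : ¬ ClosedUnderTransductions C := fun hC =>
  factorialWord_notMem_PD0LWords (h₂ _ (hC (Fin 2) (transductionsOf_mono h₁ _
    (computableWords_subset_transductionsOf _ factorialWord_mem_computableWords))))

theorem mainTheorem6 :
    (¬ ClosedUnderTransductions PD0LWords ∧ ¬ ClosedUnderTransductions NonErasingPD0LWords) ∧
    (¬ ClosedUnderErasingLetters PD0LWords ∧ ¬ ClosedUnderErasingLetters NonErasingPD0LWords) ∧
    (∀ (β : Type) [Finite β],
      transductionsOf PD0LWords β = ComputableWords β ∧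
      transductionsOf NonErasingPD0LWords β = ComputableWords β) ∧
    (∃ (β : Type) (_ : Finite β), ∃ w ∈ ComputableWords β, w ∉ PD0LWords β) := by
  have hsub := NonErasingPD0LWords_subset_PD0LWords
  refine ⟨⟨not_closedUnderTransductions hsub fun _ => subset_rfl,
      not_closedUnderTransductions (fun _ => subset_rfl) hsub⟩,
    ⟨not_closedUnderErasingLetters hsub fun _ => subset_rfl,
      not_closedUnderErasingLetters (fun _ => subset_rfl) hsub⟩,
    fun β _ => ⟨?_, ?_⟩,
    Fin 2, inferInstance, factorialWord, factorialWord_mem_computableWords,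
    factorialWord_notMem_PD0LWords⟩
  · exact (transductionsOf_PD0LWords_subset β).antisymm
      ((computableWords_subset_transductionsOf β).trans (transductionsOf_mono hsub β))
  · exact ((transductionsOf_mono hsub β).trans (transductionsOf_PD0LWords_subset β)).antisymm
      (computableWords_subset_transductionsOf β)
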